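/- **Setting.** Let $\Gamma$ be a rooted metric tree with root $o$: a locally finite combinatorial tree, each edge $e$ of which is a segment of length $|e|>0$. Let $|x|$ be the distance of $x\in\Gamma$ from $o$, write $x\preceq y$ if $x$ lies on the path from $o$ to $y$, let $gen(v)$ be the number of vertices $x\prec v$, and let the branching number $b(v)$ of a vertex $v$ be the number of edges emanating from $v$ (leading away from $o$). Assume that $\Gamma$ is regular with generating sequences $(b_n)_{n\ge0}$, $(t_n)_{n\ge0}$, that is, $b(v)=b_{gen(v)}$ and $|v|=t_{gen(v)}$ for every vertex $v$, with $b_0=1$ and $b_n\ge2$ for $n\ge1$. For $k\ge 0$ let $\Gamma_k$ be the regular tree with generating sequences $b_0(\Gamma_k)=1$, $b_n(\Gamma_k)=b_{k+n}$ $(n\ge1)$, $t_n(\Gamma_k)=t_{k+n}-t_k$ $(n\ge 0)$. **Dirac operator.** Let $L^2(\Gamma)$ be taken with respect to Lebesgue measure on the edges, and let $c\in\mathbb R$ (the speed of light, $c>0$, in applications). The Dirac operator $D_c$ in $L^2(\Gamma)\otimes\mathbb C^2$ acts on every edge, in the coordinate increasing away from the root, as $$D_cf=\frac ci\,\alpha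 f'+c^2\beta f,\qquad \alpha=\begin{pmatrix}0&-i\\ i&0\end{pmatrix},\quad \beta=\begin{pmatrix}1&0\\0&-1\end{pmatrix},$$ on the domain of all $f=(f_1,f_2)\in\bigoplus_{e}H^1(e)\otimes\mathbb C^2$ such that $f_1(o)=0$ and, at every vertex $v\neq o$, $f_1$ is continuous and the boundary value at $v$ of $f_2$ on the edge terminating at $v$ equals the sum of the boundary values at $v$ of $f_2$ on the edges emanating from $v$. The Dirac operator $D_k$ on $\Gamma_k$ is defined in the same way. **Subspaces.** For a subtree $T\subset\Gamma$ let $\mathfrak F_T$ be the space of all $u\in L^2(\Gamma)$ with $u(x)=0$ for $x\notin T$ and $u(x)=u(y)$ whenever $x,y\in T$, $|x|=|y|$. For a vertex $v$ put $T_v=\{x\in\Gamma: x\succeq v\}$, for an edge $e$ with initial vertex $v$ and terminal vertex $w$ put $T_e=e\cup T_w$, and let $\mathfrak F'_v$ be the orthogonal complement of $\mathfrak F_{T_v}$ in the orthogonal sum of the spaces $\mathfrak F_{T_e}$ over the edges $e$ emanating from $v$. For an operator $A$ that maps $\mathrm{dom}(A)\cap M$ into the subspace $M$, let $A\upharpoonright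 M$ be the operator in $M$ with domain $\mathrm{dom}(A)\cap M$ which acts as $A$. **Theorem.** Let $v$ be a vertex of $\Gamma$ with $gen(v)=k>0$. Then $D_c$ maps $\mathrm{dom}(D_c)\cap(\mathfrak F'_v\otimes\mathbb C^2)$ into $\mathfrak F'_v\otimes\mathbb C^2$, the operator $D_k$ maps $\mathrm{dom}(D_k)\cap(\mathfrak F_{\Gamma_k}\otimes\mathbb C^2)$ into $\mathfrak F_{\Gamma_k}\otimes\mathbb C^2$, and the operator $D_c\upharpoonright\mathfrak F'_v\otimes\mathbb C^2$ is unitarily equivalent to the orthogonal sum of $b_k-1$ copies of $\mathcal D_k=D_k\upharpoonright\mathfrak F_{\Gamma_k}\otimes\mathbb C^2$. -/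

import Mathlib

open MeasureTheory
open scoped ContDiff

noncomputable section

/-! # Rooted metric trees -/

/-- A rooted, locally finite tree on the vertex set `V`. -/
structure RootedGraphTree (V : Type*) where
  /-- the underlying combinatorial graph -/
  graph : SimpleGraph V
  /-- it is a tree (connected, without cycles) -/
  isTree : graph.IsTree
  /-- the root `o` -/
  root : V
  /-- every vertex has finitely many neighbours -/
  locallyFinite : ∀ v, (graph.neighborSet v).Finite

namespace RootedGraphTree

variable {V : Type*} (Γ : RootedGraphTree V)

/-- `x ⪯ y`: the vertex `x` lies on the path from the root to `y`. -/
def Prec (x y : V) : Prop :=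
  Γ.graph.dist Γ.root y = Γ.graph.dist Γ.root x + Γ.graph.dist x y

/-- The generation of `v`: the number of the vertices `x ≺ v`, that is, of the edges on the path
from the root to `v`. -/
def gen (v : V) : ℕ := Γ.graph.dist Γ.root v

/-- The edges of the tree, oriented away from the root: `⟨(v, w), _⟩` is the edge `<v, w>` which
emanates from `v` and terminates at `w`. -/
def Edge : Type _ := {p : V × V // Γ.graph.Adj p.1 p.2 ∧ Γ.Prec p.1 p.2}

variable {Γ} in
/-- The vertex from which the edge emanates. -/
def Edge.init (e : Γ.Edge) : V := e.1.1

variable {Γ} in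
/-- The vertex at which the edge terminates. -/
def Edge.term (e : Γ.Edge) : V := e.1.2

/-- The set of the edges emanating from `v`. -/
def outEdges (v : V) : Set Γ.Edge := {e | e.init = v}

/-- The branching number `b(v)`: the number of edges emanating from `v`. -/
def branching (v : V) : ℕ := (Γ.outEdges v).ncard

theorem outEdges_finite (v : V) : (Γ.outEdges v).Finite := by
  refine Set.Finite.of_finite_image (f := Edge.term) ((Γ.locallyFinite v).subset ?_) ?_
  · rintro _ ⟨e, he, rfl⟩
    have h := e.2.1
    have he' : e.1.1 = v := he
    rw [he'] at h
    exact h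
  · rintro ⟨⟨a, b⟩, h⟩ h1 ⟨⟨a', b'⟩, h'⟩ h2 h3
    have h1' : a = v := h1
    have h2' : a' = v := h2
    have h3' : b = b' := h3
    subst h1' h2' h3'
    rfl

end RootedGraphTree

/-- A rooted metric tree: every edge is a line segment of positive length. -/
structure MetricTree (V : Type*) extends RootedGraphTree V where
  /-- the length `|e|` of an edge -/
  len : toRootedGraphTree.Edge → ℝ
  len_pos : ∀ e, 0 < len e

namespace MetricTree

variable {V : Type*} (Γ : MetricTree V)

/-- The distance `|v|` of a vertex from the root: the total length of the edges on the path from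
the root to `v` (these are the edges whose terminal vertex precedes or equals `v`). -/
def height (v : V) : ℝ := ∑ᶠ e ∈ {e : Γ.Edge | Γ.Prec e.term v}, Γ.len e

/-- `Γ` is a regular tree with the generating sequences `b` and `t`: one has `b(v) = b (gen v)` and
`|v| = t (gen v)` for every vertex, where `b 0 = 1` and `b n ≥ 2` for `n > 0`. In particular the
vertices of a generation have the same branching number, and the edges of generation `n` all have
the length `t (n + 1) - t n`. -/
structure IsRegular (b : ℕ → ℕ) (t : ℕ → ℝ) : Prop where
  b_zero : b 0 = 1
  two_le_b : ∀ n, 0 < n → 2 ≤ b n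
  branching_eq : ∀ v, Γ.branching v = b (Γ.gen v)
  height_eq : ∀ v, Γ.height v = t (Γ.gen v)

/-! ## Points of the tree and the space `L²(Γ)` -/

/-- Coordinates: `⟨e, s⟩` with `0 < s < |e|` is the interior point of the edge `e` at the distance
`s` from its initial vertex. (The vertices form a null set and carry no coordinates here.) -/
abbrev Coord : Type _ := (_ : Γ.Edge) × ℝ

/-- The coordinates of the points of `Γ` (interior points of edges). -/
def points : Set Γ.Coord := {x | 0 < x.2 ∧ x.2 < Γ.len x.1}

/-- The distance `|x|` of a point from the root. -/
def norm (x : Γ.Coord) : ℝ := Γ.height x.1.init + x.2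

/-- Lebesgue measure on the edge `e`, seen as the interval `(0, |e|)`. -/
def edgeMeasure (e : Γ.Edge) : Measure ℝ := volume.restrict (Set.Ioo 0 (Γ.len e))

/-- The natural measure on `Γ`, induced by the Lebesgue measure on the edges. -/
def measure : Measure Γ.Coord :=
  Measure.sum fun e => (Γ.edgeMeasure e).map (Sigma.mk e)

/-- The Hilbert space `L²(Γ)`. -/
abbrev L2 : Type _ := Lp ℂ 2 Γ.measure

/-- The Hilbert space `L²(Γ) ⊗ ℂ²`, whose elements are spinors `f = (f₁, f₂)` (indexed by `0, 1`),
with `‖f‖² = ‖f₁‖² + ‖f₂‖²`. -/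
def Spinor : Type _ := PiLp 2 (fun _ : Fin 2 => Γ.L2)

instance : NormedAddCommGroup Γ.Spinor :=
  inferInstanceAs (NormedAddCommGroup (PiLp 2 (fun _ : Fin 2 => Γ.L2)))

instance : InnerProductSpace ℂ Γ.Spinor :=
  inferInstanceAs (InnerProductSpace ℂ (PiLp 2 (fun _ : Fin 2 => Γ.L2)))

instance : CompleteSpace Γ.Spinor :=
  inferInstanceAs (CompleteSpace (PiLp 2 (fun _ : Fin 2 => Γ.L2)))

variable {Γ} in
/-- The components of a spinor. -/
def Spinor.comp (f : Γ.Spinor) (i : Fin 2) : Γ.L2 := f.ofLp i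

variable {Γ} in
/-- The spinor with given components. -/
def Spinor.mk (u : Fin 2 → Γ.L2) : Γ.Spinor := WithLp.toLp 2 u

variable {Γ} in
theorem Spinor.comp_mk (u : Fin 2 → Γ.L2) (i : Fin 2) : (Spinor.mk u).comp i = u i := rfl

variable {Γ} in
theorem Spinor.comp_zero (i : Fin 2) : (0 : Γ.Spinor).comp i = 0 := rfl

variable {Γ} in
theorem Spinor.comp_add (f g : Γ.Spinor) (i : Fin 2) : (f + g).comp i = f.comp i + g.comp i := rfl

variable {Γ} in
theorem Spinor.comp_smul (a : ℂ) (f : Γ.Spinor) (i : Fin 2) : (a • f).comp i = a • f.comp i := rfl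

variable {Γ} in
theorem Spinor.ext {f g : Γ.Spinor} (h : ∀ i, f.comp i = g.comp i) : f = g := PiLp.ext h

variable {Γ} in
theorem Spinor.inner_eq (f g : Γ.Spinor) :
    inner ℂ f g = ∑ i, inner ℂ (f.comp i) (g.comp i) := PiLp.inner_apply _ _

/-! ## Subtrees and the subspaces associated with them -/

/-- The subtree `T_v` of the points `x ⪰ v`. -/
def vertexSubtree (v : V) : Set Γ.Coord := {x | x ∈ Γ.points ∧ Γ.Prec v x.1.init}

/-- The subtree `T_e = e ∪ T_w` for the edge `e = <v, w>`. -/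
def edgeSubtree (e : Γ.Edge) : Set Γ.Coord :=
  {x | x ∈ Γ.points ∧ x.1 = e} ∪ Γ.vertexSubtree e.term

/-- The space `F_T` of the functions `u ∈ L²(Γ)` which vanish outside `T` and depend only on `|x|`
for `x ∈ T`. -/
def symmetricOn (T : Set Γ.Coord) : Submodule ℂ Γ.L2 where
  carrier := {u | ∃ g : Γ.Coord → ℂ, u =ᵐ[Γ.measure] g ∧
    (∀ x ∈ Γ.points, x ∉ T → g x = 0) ∧
    (∀ x ∈ T, ∀ y ∈ T, Γ.norm x = Γ.norm y → g x = g y)}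
  zero_mem' := ⟨0, Lp.coeFn_zero _ _ _, fun _ _ _ => rfl, fun _ _ _ _ _ => rfl⟩
  add_mem' := by
    rintro u w ⟨g, h1, h2, h3⟩ ⟨g', h1', h2', h3'⟩
    refine ⟨g + g', (Lp.coeFn_add u w).trans (h1.add h1'), fun x hx hT => ?_,
      fun x hx y hy hxy => ?_⟩
    · simp [h2 x hx hT, h2' x hx hT]
    · simp [h3 x hx y hy hxy, h3' x hx y hy hxy]
  smul_mem' := by
    rintro a u ⟨g, h1, h2, h3⟩
    refine ⟨a • g, (Lp.coeFn_smul a u).trans (h1.const_smul a), fun x hx hT => ?_,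
      fun x hx y hy hxy => ?_⟩
    · simp [h2 x hx hT]
    · simp [h3 x hx y hy hxy]

/-- The space `F_Γ` of the symmetric functions on the whole tree. -/
def FSymm : Submodule ℂ Γ.L2 := Γ.symmetricOn Γ.points

/-- The space `F_v = F_{T_v}`. -/
def FVertex (v : V) : Submodule ℂ Γ.L2 := Γ.symmetricOn (Γ.vertexSubtree v)

/-- The space `F_e = F_{T_e}`. -/
def FEdge (e : Γ.Edge) : Submodule ℂ Γ.L2 := Γ.symmetricOn (Γ.edgeSubtree e)

/-- The (orthogonal) sum of the spaces `F_e` over the edges `e` emanating from `v`. -/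
def FTilde (v : V) : Submodule ℂ Γ.L2 := ⨆ e ∈ Γ.outEdges v, Γ.FEdge e

/-- The orthogonal complement `F'_v` of `F_v` in the sum of the `F_e`, `e` emanating from `v`. -/
def FPrime (v : V) : Submodule ℂ Γ.L2 := Γ.FTilde v ⊓ (Γ.FVertex v)ᗮ

variable {Γ} in
/-- `F ⊗ ℂ²` as a subspace of `L²(Γ) ⊗ ℂ²`. -/
def tensorC2 (F : Submodule ℂ Γ.L2) : Submodule ℂ Γ.Spinor where
  carrier := {f | ∀ i, f.comp i ∈ F}
  zero_mem' := fun _ => F.zero_mem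
  add_mem' := fun hf hg i => F.add_mem (hf i) (hg i)
  smul_mem' := fun a _ hf i => F.smul_mem a (hf i)

/-! ## The Dirac operator -/

/-- `u'` is the weak derivative of `u` on every edge (in the direction away from the root). As both
are in `L²(Γ)`, this says that `u` is in the orthogonal sum of the spaces `H¹(e)`. -/
def IsWeakDeriv (u u' : Γ.L2) : Prop :=
  ∀ (e : Γ.Edge) (φ : ℝ → ℝ), ContDiff ℝ ∞ φ → HasCompactSupport φ →
    tsupport φ ⊆ Set.Ioo 0 (Γ.len e) →
    ∫ s, deriv φ s • u ⟨e, s⟩ ∂(Γ.edgeMeasure e) = - ∫ s, φ s • u' ⟨e, s⟩ ∂(Γ.edgeMeasure e)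

/-- `F e` is, for every edge `e`, the representative of `u` on `e` which is continuous up to the
endpoints. Its values at `0` and `|e|` are the boundary values of `u` on `e`. -/
def IsContRep (u : Γ.L2) (F : Γ.Edge → ℝ → ℂ) : Prop :=
  ∀ e, ContinuousOn (F e) (Set.Icc 0 (Γ.len e)) ∧ ∀ᵐ s ∂(Γ.edgeMeasure e), u ⟨e, s⟩ = F e s

/-- The boundary condition at the root and the matching conditions at the other vertices, for the
edgewise continuous components `F₁, F₂` of a spinor: the first component vanishes at the root, at
every other vertex the first component is continuous, and the boundary values of the second
component satisfy: incoming value = sum of the outgoing values. -/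
structure Matching (F₁ F₂ : Γ.Edge → ℝ → ℂ) : Prop where
  root : ∀ e ∈ Γ.outEdges Γ.root, F₁ e 0 = 0
  cont : ∀ e, ∀ e' ∈ Γ.outEdges e.term, F₁ e' 0 = F₁ e (Γ.len e)
  kirchhoff : ∀ e, F₂ e (Γ.len e) = ∑ᶠ e' ∈ Γ.outEdges e.term, F₂ e' 0

/-- The Dirac matrix `α`. -/
def diracAlpha : Matrix (Fin 2) (Fin 2) ℂ := !![0, -Complex.I; Complex.I, 0]

/-- The Dirac matrix `β`. -/
def diracBeta : Matrix (Fin 2) (Fin 2) ℂ := !![1, 0; 0, -1]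

/-- The spinor `f` belongs to the domain of the Dirac operator, and `f'` is its derivative. -/
def IsDiracPair (f f' : Γ.Spinor) : Prop :=
  (∀ i, Γ.IsWeakDeriv (f.comp i) (f'.comp i)) ∧
    ∃ F : Fin 2 → Γ.Edge → ℝ → ℂ, (∀ i, Γ.IsContRep (f.comp i) (F i)) ∧ Γ.Matching (F 0) (F 1)

/-- The expression `α · (c / i) f' + c² β f`. -/
def diracExpr (c : ℝ) (f f' : Γ.Spinor) : Γ.Spinor :=
  Spinor.mk fun i => ∑ j, (((c : ℂ) / Complex.I * diracAlpha i j) • f'.comp j +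
    ((c : ℂ) ^ 2 * diracBeta i j) • f.comp j)

theorem edge_map_le (e : Γ.Edge) : (Γ.edgeMeasure e).map (Sigma.mk e) ≤ Γ.measure :=
  Measure.le_sum (fun e => (Γ.edgeMeasure e).map (Sigma.mk e)) e

theorem measurable_mk (e : Γ.Edge) : Measurable (fun s : ℝ => (⟨e, s⟩ : Γ.Coord)) := by
  intro s hs
  exact (MeasurableSpace.measurableSet_iInf.1 hs) e

theorem ae_edge {p : Γ.Coord → Prop} (h : ∀ᵐ x ∂Γ.measure, p x) (e : Γ.Edge) :
    ∀ᵐ s ∂(Γ.edgeMeasure e), p ⟨e, s⟩ :=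
  ae_of_ae_map (Γ.measurable_mk e).aemeasurable (ae_mono (Γ.edge_map_le e) h)

theorem memLp_edge (u : Γ.L2) (e : Γ.Edge) :
    MemLp (fun s : ℝ => u ⟨e, s⟩) 2 (Γ.edgeMeasure e) :=
  ((Lp.memLp u).mono_measure (Γ.edge_map_le e)).comp_of_map (Γ.measurable_mk e).aemeasurable

instance (e : Γ.Edge) : IsFiniteMeasure (Γ.edgeMeasure e) := by
  unfold edgeMeasure; infer_instance

theorem integrable_edge (u : Γ.L2) (e : Γ.Edge) :
    Integrable (fun s : ℝ => u ⟨e, s⟩) (Γ.edgeMeasure e) :=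
  (Γ.memLp_edge u e).integrable (by norm_num)

theorem integrable_smul_edge (u : Γ.L2) (e : Γ.Edge) {ψ : ℝ → ℝ} (hψ : Continuous ψ)
    (hs : HasCompactSupport ψ) :
    Integrable (fun s : ℝ => ψ s • u ⟨e, s⟩) (Γ.edgeMeasure e) := by
  obtain ⟨C, hC⟩ := hψ.bounded_above_of_compact_support hs
  exact (Γ.integrable_edge u e).bdd_smul C hψ.aestronglyMeasurable (ae_of_all _ hC)

theorem IsWeakDeriv.zero : Γ.IsWeakDeriv 0 0 := by
  intro e φ _ _ _
  have h : ∀ ψ : ℝ → ℝ, ∫ s, ψ s • (0 : Γ.L2) ⟨e, s⟩ ∂(Γ.edgeMeasure e) = 0 := fun ψ =>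
    (integral_congr_ae ((Γ.ae_edge (Lp.coeFn_zero ℂ 2 Γ.measure) e).mono fun s hs => by
      rw [hs]; exact smul_zero _)).trans (integral_zero' _ _)
  rw [h, h, neg_zero]

variable {Γ} in
theorem IsWeakDeriv.add {u u' w w' : Γ.L2} (h : Γ.IsWeakDeriv u u') (h' : Γ.IsWeakDeriv w w') :
    Γ.IsWeakDeriv (u + w) (u' + w') := by
  intro e φ h1 h2 h3
  have hd : Continuous (deriv φ) := h1.continuous_deriv (by simp)
  have key : ∀ ψ : ℝ → ℝ, Continuous ψ → HasCompactSupport ψ → ∀ u w : Γ.L2,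
      ∫ s, ψ s • (u + w) ⟨e, s⟩ ∂(Γ.edgeMeasure e) =
        ∫ s, ψ s • u ⟨e, s⟩ ∂(Γ.edgeMeasure e) + ∫ s, ψ s • w ⟨e, s⟩ ∂(Γ.edgeMeasure e) := by
    intro ψ hψ hs u w
    rw [← integral_add (Γ.integrable_smul_edge u e hψ hs) (Γ.integrable_smul_edge w e hψ hs)]
    refine integral_congr_ae ((Γ.ae_edge (Lp.coeFn_add u w) e).mono fun s hs => ?_)
    simp only [hs]
    exact smul_add _ _ _
  rw [key _ hd h2.deriv, key _ h1.continuous h2, h e φ h1 h2 h3, h' e φ h1 h2 h3, neg_add]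

variable {Γ} in
theorem IsWeakDeriv.smul {u u' : Γ.L2} (h : Γ.IsWeakDeriv u u') (a : ℂ) :
    Γ.IsWeakDeriv (a • u) (a • u') := by
  intro e φ h1 h2 h3
  have key : ∀ (ψ : ℝ → ℝ) (u : Γ.L2), ∫ s, ψ s • (a • u) ⟨e, s⟩ ∂(Γ.edgeMeasure e) =
      a • ∫ s, ψ s • u ⟨e, s⟩ ∂(Γ.edgeMeasure e) := by
    intro ψ u
    rw [← integral_smul]
    refine integral_congr_ae ((Γ.ae_edge (Lp.coeFn_smul a u) e).mono fun s hs => ?_)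
    simp only [hs]
    exact smul_comm (ψ s) a (u ⟨e, s⟩)
  rw [key, key, h e φ h1 h2 h3, smul_neg]

variable {Γ} in
theorem IsWeakDeriv.eq_zero {u' : Γ.L2} (h : Γ.IsWeakDeriv 0 u') : u' = 0 := by
  have hae : ∀ e, ∀ᵐ s ∂(Γ.edgeMeasure e), u' ⟨e, s⟩ = 0 := by
    intro e
    have key := isOpen_Ioo.ae_eq_zero_of_integral_contDiff_smul_eq_zero
      (μ := Γ.edgeMeasure e) (U := Set.Ioo 0 (Γ.len e)) (f := fun s : ℝ => u' ⟨e, s⟩)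
      ((Γ.integrable_edge u' e).locallyIntegrable.locallyIntegrableOn _) (by
        intro φ h1 h2 h3
        have h0 := Γ.ae_edge (Lp.coeFn_zero ℂ 2 Γ.measure) e
        have := h e φ h1 h2 h3
        rw [integral_congr_ae (g := fun _ => (0 : ℂ)) (h0.mono fun s hs => by rw [hs]; exact smul_zero _)] at this
        simpa using this.symm)
    have hmem : ∀ᵐ s ∂(Γ.edgeMeasure e), s ∈ Set.Ioo 0 (Γ.len e) :=
      ae_restrict_mem measurableSet_Ioo
    filter_upwards [key, hmem] with s h1 h2 using h1 h2
  have hm : MeasurableSet {x | u' x = 0} :=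
    (Lp.stronglyMeasurable u').measurable (measurableSet_singleton 0)
  refine (Lp.eq_zero_iff_ae_eq_zero).2 ?_
  exact (Measure.ae_sum_iff' hm).2 fun e =>
    (ae_map_iff (Γ.measurable_mk e).aemeasurable hm).2 (hae e)

theorem IsDiracPair.zero : Γ.IsDiracPair 0 0 := by
  refine ⟨fun i => IsWeakDeriv.zero Γ, fun _ _ _ => 0, fun i e => ⟨continuousOn_const, ?_⟩, ?_⟩
  · exact Γ.ae_edge (Lp.coeFn_zero ℂ 2 Γ.measure) e
  · exact ⟨fun _ _ => rfl, fun _ _ _ => rfl, fun _ => by simp⟩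

variable {Γ} in
theorem IsDiracPair.add {f f' g g' : Γ.Spinor} (hf : Γ.IsDiracPair f f')
    (hg : Γ.IsDiracPair g g') : Γ.IsDiracPair (f + g) (f' + g') := by
  obtain ⟨h1, F, h2, h3⟩ := hf
  obtain ⟨k1, G, k2, k3⟩ := hg
  refine ⟨fun i => (h1 i).add (k1 i), fun i e s => F i e s + G i e s,
    fun i e => ⟨(h2 i e).1.add (k2 i e).1, ?_⟩, ?_, ?_, ?_⟩
  · filter_upwards [(h2 i e).2, (k2 i e).2, Γ.ae_edge (Lp.coeFn_add (f.comp i) (g.comp i)) e]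
      with s a1 a2 a3
    rw [Spinor.comp_add, a3, Pi.add_apply, a1, a2]
  · intro e he
    simp [h3.root e he, k3.root e he]
  · intro e e' he'
    simp [h3.cont e e' he', k3.cont e e' he']
  · intro e
    change F 1 e _ + G 1 e _ = ∑ᶠ e' ∈ Γ.outEdges e.term, (F 1 e' 0 + G 1 e' 0)
    rw [finsum_mem_add_distrib (Γ.outEdges_finite _), h3.kirchhoff e, k3.kirchhoff e]

variable {Γ} in
theorem IsDiracPair.smul {f f' : Γ.Spinor} (hf : Γ.IsDiracPair f f') (a : ℂ) :
    Γ.IsDiracPair (a • f) (a • f') := by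
  obtain ⟨h1, F, h2, h3⟩ := hf
  refine ⟨fun i => (h1 i).smul a, fun i e s => a * F i e s,
    fun i e => ⟨continuousOn_const.mul (h2 i e).1, ?_⟩, ?_, ?_, ?_⟩
  · filter_upwards [(h2 i e).2, Γ.ae_edge (Lp.coeFn_smul a (f.comp i)) e] with s a1 a3
    rw [Spinor.comp_smul, a3, Pi.smul_apply, a1, smul_eq_mul]
  · intro e he
    simp [h3.root e he]
  · intro e e' he'
    simp [h3.cont e e' he']
  · intro e
    change a * F 1 e _ = ∑ᶠ e' ∈ Γ.outEdges e.term, a * F 1 e' 0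
    rw [← mul_finsum_mem' _ _ (Γ.outEdges_finite _), h3.kirchhoff e]

/-- The graph of the Dirac operator: the pairs `(f, g)` with `f` in the domain and
`g = α · (c / i) f' + c² β f`. -/
def diracGraph (c : ℝ) : Submodule ℂ (Γ.Spinor × Γ.Spinor) where
  carrier := {p | ∃ f', Γ.IsDiracPair p.1 f' ∧ p.2 = Γ.diracExpr c p.1 f'}
  zero_mem' := ⟨0, IsDiracPair.zero Γ, Spinor.ext fun i => by
    simp [diracExpr, Spinor.comp_mk, Spinor.comp_zero]⟩
  add_mem' := by
    rintro p q ⟨f', h, hp⟩ ⟨g', h', hq⟩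
    refine ⟨f' + g', h.add h', ?_⟩
    refine Spinor.ext fun i => ?_
    simp only [Prod.snd_add, Prod.fst_add, hp, hq, diracExpr, Spinor.comp_add, Spinor.comp_mk, Fin.sum_univ_two]
    module
  smul_mem' := by
    rintro a p ⟨f', h, hp⟩
    refine ⟨a • f', h.smul a, ?_⟩
    refine Spinor.ext fun i => ?_
    simp only [Prod.smul_snd, Prod.smul_fst, hp, diracExpr, Spinor.comp_smul, Spinor.comp_mk, Fin.sum_univ_two]
    module

theorem diracGraph_single_valued (c : ℝ) (p : Γ.Spinor × Γ.Spinor) (hp : p ∈ Γ.diracGraph c)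
    (h0 : p.1 = 0) : p.2 = 0 := by
  obtain ⟨f', h, hp⟩ := hp
  rw [h0] at h hp
  have hf' : f' = 0 := by
    refine Spinor.ext fun i => ?_
    exact (h.1 i).eq_zero
  rw [hp, hf']
  refine Spinor.ext fun i => ?_
  simp [diracExpr, Spinor.comp_mk, Spinor.comp_zero]

/-- The Dirac operator `D_c` on the metric tree `Γ`, an unbounded operator in `L²(Γ) ⊗ ℂ²`. -/
def dirac (c : ℝ) : Γ.Spinor →ₗ.[ℂ] Γ.Spinor := (Γ.diracGraph c).toLinearPMap

theorem dirac_graph (c : ℝ) : (Γ.dirac c).graph = Γ.diracGraph c :=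
  Submodule.toLinearPMap_graph_eq _ (Γ.diracGraph_single_valued c)

end MetricTree

/-! # Parts, orthogonal sums and unitary equivalence of unbounded operators -/

/-- The subspace `M` is invariant under the unbounded operator `T`. -/
def LinearPMap.LeavesInvariant {E : Type*} [NormedAddCommGroup E] [InnerProductSpace ℂ E]
    (T : E →ₗ.[ℂ] E) (M : Submodule ℂ E) : Prop :=
  ∀ x : T.domain, (x : E) ∈ M → T x ∈ M

/-- The part of `T` in the subspace `M`: the operator in `M` which acts as `T` on those
`x ∈ M ∩ dom T` for which `T x ∈ M`. -/
def LinearPMap.part {E : Type*} [NormedAddCommGroup E] [InnerProductSpace ℂ E]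
    (T : E →ₗ.[ℂ] E) (M : Submodule ℂ E) : M →ₗ.[ℂ] M where
  domain :=
    { carrier := {x | ∃ h : (x : E) ∈ T.domain, T ⟨x, h⟩ ∈ M}
      zero_mem' := ⟨T.domain.zero_mem, by
        have : T ⟨((0 : M) : E), T.domain.zero_mem⟩ = 0 := T.map_zero
        rw [this]; exact M.zero_mem⟩
      add_mem' := by
        rintro x y ⟨hx, hx'⟩ ⟨hy, hy'⟩
        refine ⟨T.domain.add_mem hx hy, ?_⟩
        have : T ⟨((x + y : M) : E), T.domain.add_mem hx hy⟩ = T ⟨x, hx⟩ + T ⟨y, hy⟩ :=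
          T.map_add ⟨x, hx⟩ ⟨y, hy⟩
        rw [this]; exact M.add_mem hx' hy'
      smul_mem' := by
        rintro a x ⟨hx, hx'⟩
        refine ⟨T.domain.smul_mem a hx, ?_⟩
        have : T ⟨((a • x : M) : E), T.domain.smul_mem a hx⟩ = a • T ⟨x, hx⟩ :=
          T.map_smul a ⟨x, hx⟩
        rw [this]; exact M.smul_mem a hx' }
  toFun :=
    { toFun := fun x => ⟨T ⟨((x : M) : E), x.2.1⟩, x.2.2⟩
      map_add' := fun x y => Subtype.ext (T.map_add ⟨_, x.2.1⟩ ⟨_, y.2.1⟩)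
      map_smul' := fun a x => Subtype.ext (T.map_smul a ⟨_, x.2.1⟩) }

/-- The orthogonal sum of `r` copies of the unbounded operator `T`. -/
def LinearPMap.copies {E : Type*} [NormedAddCommGroup E] [InnerProductSpace ℂ E]
    (T : E →ₗ.[ℂ] E) (r : ℕ) :
    PiLp 2 (fun _ : Fin r => E) →ₗ.[ℂ] PiLp 2 (fun _ : Fin r => E) where
  domain :=
    { carrier := {x | ∀ i, x i ∈ T.domain}
      zero_mem' := fun _ => T.domain.zero_mem
      add_mem' := fun hx hy i => T.domain.add_mem (hx i) (hy i)
      smul_mem' := fun a _ hx i => T.domain.smul_mem a (hx i) }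
  toFun :=
    { toFun := fun x => WithLp.toLp 2 fun i => T ⟨x.1 i, x.2 i⟩
      map_add' := fun x y => by
        ext1 i
        exact T.map_add ⟨x.1 i, x.2 i⟩ ⟨y.1 i, y.2 i⟩
      map_smul' := fun a x => by
        ext1 i
        exact T.map_smul a ⟨x.1 i, x.2 i⟩ }

/-- Unitary equivalence of unbounded operators: some unitary map carries the graph of `S` onto the
graph of `T`, i.e. maps `dom S` onto `dom T` and intertwines `S` with `T`. -/
def LinearPMap.UnitarilyEquiv {E F : Type*} [NormedAddCommGroup E] [InnerProductSpace ℂ E]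
    [NormedAddCommGroup F] [InnerProductSpace ℂ F] (S : E →ₗ.[ℂ] E) (T : F →ₗ.[ℂ] F) : Prop :=
  ∃ U : E ≃ₗᵢ[ℂ] F, ∀ x y : E, (x, y) ∈ S.graph ↔ (U x, U y) ∈ T.graph

end

/-!
The branches `T_a` of a regular tree at a vertex `v` of generation `k`, one for each edge `a`
emanating from `v`, all look like `Γ_k`, and symmetric functions see only the levels of the edges.
So a function in the orthogonal sum of the spaces `F_{T_a}` is a family `(u_a)` of symmetric
functions on `Γ_k`; being orthogonal to `F_v` means `∑ u_a = 0` (`BranchMatch.mem_FPrime_iff`).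
Hence `F'_v` is the tensor product of `F_{Γ_k}` with the space of the vectors in `ℂ^{b_k}` whose
coordinates sum up to zero. An orthonormal basis of this `(b_k - 1)`-dimensional space
(`BalancedBasis`) gives the unitary map onto `b_k - 1` copies of `F_{Γ_k}`
(`BalancedBasis.exists_unitary`).

The Dirac operator acts on the family `(u_a)` entry by entry
(`BranchMatch.mem_diracGraph_iff_restrict`), so it commutes with the change to these coordinates.
The only delicate point is the vertex `v`. A function of `F'_v` vanishes on the edge which
terminates at `v`, and this edge exists as `k > 0`. By continuity the first components vanish at the
start of the branches, which is the boundary condition at the root of `Γ_k`; conversely, the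
matching condition at `v` for the second component asks that the boundary values of the `u_a` sum up
to zero, which is automatic.

The branches are compared with `Γ_k` by a bijection of the edges which preserves levels and
lengths, but not necessarily adjacency (`exists_branch_equiv`, a counting argument). For symmetric
functions the matching conditions relate the boundary values on consecutive levels
(`MetricTree.LevelMatching`), so they are transported by such a bijection. Invariance of the
subspaces follows from the uniqueness of weak derivatives: they inherit all linear relations between
the values on different edges of the same length.
-/

noncomputable section

/-! ### Combinatorics of a rooted tree -/

namespace RootedGraphTree

variable {V : Type*} {Γ : RootedGraphTree V}

/-- The level of an edge: the generation of its initial vertex. -/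
def Edge.level (e : Γ.Edge) : ℕ := Γ.gen e.init

theorem gen_root : Γ.gen Γ.root = 0 := SimpleGraph.dist_self

theorem eq_root_of_gen_eq_zero {x : V} (h : Γ.gen x = 0) : x = Γ.root :=
  (Γ.isTree.connected.dist_eq_zero_iff.1 h).symm

theorem Edge.gen_term (e : Γ.Edge) : Γ.gen e.term = e.level + 1 := by
  have h := e.2.2
  unfold Prec at h
  rw [SimpleGraph.dist_eq_one_iff_adj.2 e.2.1] at h
  exact h

theorem Edge.term_ne_root (e : Γ.Edge) : e.term ≠ Γ.root := by
  intro h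
  have := e.gen_term
  rw [h, gen_root] at this
  omega

/-- A vertex has at most one parent, as paths in a tree are unique. -/
theorem parent_unique {p q w : V} (hp : Γ.graph.Adj p w) (hq : Γ.graph.Adj q w)
    (hpw : Γ.gen w = Γ.gen p + 1) (hqw : Γ.gen w = Γ.gen q + 1) : p = q := by
  obtain ⟨P, hP⟩ := Γ.isTree.connected.exists_walk_length_eq_dist Γ.root p
  obtain ⟨Q, hQ⟩ := Γ.isTree.connected.exists_walk_length_eq_dist Γ.root q
  have hPp : (P.concat hp).IsPath := by
    apply SimpleGraph.Walk.isPath_of_length_eq_dist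
    rw [SimpleGraph.Walk.length_concat, hP]
    exact hpw.symm
  have hQp : (Q.concat hq).IsPath := by
    apply SimpleGraph.Walk.isPath_of_length_eq_dist
    rw [SimpleGraph.Walk.length_concat, hQ]
    exact hqw.symm
  have h := (Γ.isTree.existsUnique_path Γ.root w).unique hPp hQp
  have := congrArg SimpleGraph.Walk.penultimate h
  simpa using this

theorem Edge.term_injective : Function.Injective (Edge.term : Γ.Edge → V) := by
  intro e e' h
  have h1 : e.init = e'.init := by
    refine parent_unique (w := e.term) e.2.1 ?_ e.gen_term ?_
    · rw [h]; exact e'.2.1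
    · rw [h]; exact e'.gen_term
  exact Subtype.ext (Prod.ext h1 h)

theorem exists_adj_of_ne {x w : V} (h : x ≠ w) :
    ∃ p, Γ.graph.Adj p w ∧ Γ.graph.dist x w = Γ.graph.dist x p + 1 := by
  obtain ⟨P, hP⟩ := Γ.isTree.connected.exists_walk_length_eq_dist x w
  have hn : ¬ P.Nil := fun hn => h hn.eq
  refine ⟨P.penultimate, P.adj_penultimate hn, le_antisymm ?_ ?_⟩
  · refine (Γ.isTree.connected.dist_triangle (v := P.penultimate)).trans ?_
    rw [SimpleGraph.dist_eq_one_iff_adj.2 (P.adj_penultimate hn)]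
  · have h1 := SimpleGraph.dist_le P.dropLast
    have h2 := SimpleGraph.Walk.length_dropLast_add_one hn
    omega

/-- The edge `<p, w>` from a parent `p` of `w`. -/
theorem exists_edge_of_adj {p w : V} (h : Γ.graph.Adj p w) (hg : Γ.gen w = Γ.gen p + 1) :
    ∃ e : Γ.Edge, e.init = p ∧ e.term = w :=
  ⟨⟨(p, w), h, by unfold Prec; rw [SimpleGraph.dist_eq_one_iff_adj.2 h]; exact hg⟩, rfl, rfl⟩

theorem exists_edge_term {w : V} (h : w ≠ Γ.root) : ∃ e : Γ.Edge, e.term = w := by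
  obtain ⟨p, hp, hd⟩ := exists_adj_of_ne (Γ := Γ) h.symm
  obtain ⟨e, -, he⟩ := exists_edge_of_adj hp hd
  exact ⟨e, he⟩

theorem vertex_induction {P : V → Prop} (root : P Γ.root)
    (step : ∀ e : Γ.Edge, P e.init → P e.term) (x : V) : P x := by
  induction hn : Γ.gen x generalizing x with
  | zero => rw [eq_root_of_gen_eq_zero hn]; exact root
  | succ n ih =>
    have hx : x ≠ Γ.root := by rintro rfl; rw [gen_root] at hn; omega
    obtain ⟨e, rfl⟩ := exists_edge_term hx
    have := e.gen_term
    exact step e (ih _ (by unfold Edge.level at this; omega))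

theorem prec_refl (x : V) : Γ.Prec x x := by simp [Prec]

theorem prec_root (x : V) : Γ.Prec Γ.root x := by simp [Prec]

theorem gen_le_of_prec {x y : V} (h : Γ.Prec x y) : Γ.gen x ≤ Γ.gen y := by
  unfold Prec at h; unfold gen; omega

theorem Edge.prec (e : Γ.Edge) : Γ.Prec e.init e.term := e.2.2

theorem Prec.trans {x y z : V} (h : Γ.Prec x y) (h' : Γ.Prec y z) : Γ.Prec x z := by
  unfold Prec at *
  have h1 := Γ.isTree.connected.dist_triangle (u := x) (v := y) (w := z)
  have h2 := Γ.isTree.connected.dist_triangle (u := Γ.root) (v := x) (w := z)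
  omega

theorem prec_root_iff {x : V} : Γ.Prec x Γ.root ↔ x = Γ.root := by
  refine ⟨fun h => eq_root_of_gen_eq_zero ?_, fun h => h ▸ prec_refl _⟩
  have := gen_le_of_prec h
  rw [gen_root] at this
  omega

/-- The predecessors of `w` are `w` and the predecessors of its parent. -/
theorem Edge.prec_term_iff (e : Γ.Edge) {x : V} :
    Γ.Prec x e.term ↔ x = e.term ∨ Γ.Prec x e.init := by
  constructor
  · intro h
    by_cases hx : x = e.term
    · exact Or.inl hx
    right
    obtain ⟨p, hp, hd⟩ := exists_adj_of_ne (Γ := Γ) hx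
    have h1 := Γ.isTree.connected.dist_triangle (u := Γ.root) (v := x) (w := p)
    have h2 := Γ.isTree.connected.dist_triangle (u := Γ.root) (v := p) (w := e.term)
    rw [SimpleGraph.dist_eq_one_iff_adj.2 hp] at h2
    have h3 := e.gen_term
    unfold Edge.level gen at h3
    unfold Prec at h ⊢
    have hpe : p = e.init := parent_unique hp e.2.1 (by unfold gen; omega) e.gen_term
    subst hpe
    omega
  · rintro (rfl | h)
    · exact prec_refl _
    · exact h.trans e.prec

theorem not_prec_term_init (e : Γ.Edge) : ¬ Γ.Prec e.term e.init := by
  intro h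
  have h1 := gen_le_of_prec h
  have h2 := e.gen_term
  unfold Edge.level at h2
  omega

/-- Two predecessors of a vertex in the same generation coincide. -/
theorem Prec.eq_of_gen_eq {x x' y : V} (h : Γ.Prec x y) (h' : Γ.Prec x' y)
    (hg : Γ.gen x = Γ.gen x') : x = x' := by
  induction y using vertex_induction (Γ := Γ) with
  | root => rw [prec_root_iff.1 h, prec_root_iff.1 h']
  | step e ih =>
    have key : ∀ z, Γ.Prec z e.init → Γ.gen z ≠ Γ.gen e.term := by
      intro z hz hz'
      have h1 := gen_le_of_prec hz
      have h2 := e.gen_term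
      unfold Edge.level at h2
      omega
    rcases e.prec_term_iff.1 h with rfl | h1 <;> rcases e.prec_term_iff.1 h' with rfl | h2
    · rfl
    · exact (key _ h2 hg.symm).elim
    · exact (key _ h1 hg).elim
    · exact ih h1 h2

theorem finite_setOf_prec_term (y : V) : {e : Γ.Edge | Γ.Prec e.term y}.Finite := by
  induction y using vertex_induction (Γ := Γ) with
  | root =>
    convert Set.finite_empty
    ext e
    simpa [prec_root_iff] using e.term_ne_root
  | step e ih =>
    refine (ih.insert e).subset fun e' he' => ?_
    rcases e.prec_term_iff.1 he' with h | h
    · exact Or.inl (Edge.term_injective h)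
    · exact Or.inr h

/-! ### Branches of the tree -/

/-- The edges of the branch `T_w`, together with the edge which terminates at `w`. For
`w = e.term` these are the edges of the subtree `T_e`. -/
def branch (Γ : RootedGraphTree V) (w : V) : Set Γ.Edge := {e | Γ.Prec w e.term}

theorem mem_branch_term_iff {a e : Γ.Edge} :
    e ∈ Γ.branch a.term ↔ e = a ∨ Γ.Prec a.term e.init := by
  change Γ.Prec a.term e.term ↔ _
  rw [e.prec_term_iff]
  refine or_congr_left ⟨fun h => (Edge.term_injective h).symm, fun h => h ▸ rfl⟩

theorem level_le_of_mem_branch {a e : Γ.Edge} (h : e ∈ Γ.branch a.term) :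
    a.level ≤ e.level := by
  have h1 := gen_le_of_prec (show Γ.Prec a.term e.term from h)
  rw [a.gen_term, e.gen_term] at h1
  omega

theorem eq_of_mem_branch_of_level_eq {a e : Γ.Edge} (h : e ∈ Γ.branch a.term)
    (hl : e.level = a.level) : e = a := by
  refine Edge.term_injective (Prec.eq_of_gen_eq (prec_refl _) h ?_)
  rw [a.gen_term, e.gen_term, hl]

/-- The edges after `v` are distributed over the branches of the edges emanating from `v`. -/
theorem exists_mem_branch {v : V} {e : Γ.Edge} (h : Γ.Prec v e.init) :
    ∃ a ∈ Γ.outEdges v, e ∈ Γ.branch a.term := by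
  obtain ⟨y, hy⟩ : ∃ y, y = e.init := ⟨_, rfl⟩
  induction y using vertex_induction (Γ := Γ) generalizing e with
  | root =>
    rw [← hy, prec_root_iff] at h
    exact ⟨e, hy.symm.trans h.symm, prec_refl _⟩
  | step e' ih =>
    by_cases hv : v = e.init
    · exact ⟨e, hv.symm, prec_refl _⟩
    rw [← hy] at h hv
    obtain ⟨a, ha, hae⟩ := ih ((e'.prec_term_iff.1 h).resolve_left hv) rfl
    refine ⟨a, ha, ?_⟩
    exact Prec.trans (show Γ.Prec a.term e'.term from hae) (hy ▸ e.prec)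

theorem prec_init_of_mem_branch {v : V} {a e : Γ.Edge} (ha : a ∈ Γ.outEdges v)
    (h : e ∈ Γ.branch a.term) : Γ.Prec v e.init := by
  rcases mem_branch_term_iff.1 h with rfl | h
  · rw [show e.init = v from ha]; exact prec_refl v
  · exact (show a.init = v from ha) ▸ a.prec.trans h

theorem branch_disjoint {v : V} {a a' e : Γ.Edge} (ha : a ∈ Γ.outEdges v)
    (ha' : a' ∈ Γ.outEdges v) (h : e ∈ Γ.branch a.term) (h' : e ∈ Γ.branch a'.term) : a = a' := by
  refine Edge.term_injective (Prec.eq_of_gen_eq h h' ?_)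
  rw [a.gen_term, a'.gen_term, Edge.level, Edge.level, show a.init = v from ha,
    show a'.init = v from ha']

/-- An edge which continues an edge of a branch is in that branch. -/
theorem mem_branch_of_mem_outEdges {w : V} {e e' : Γ.Edge} (h : e ∈ Γ.branch w)
    (he' : e' ∈ Γ.outEdges e.term) : e' ∈ Γ.branch w :=
  Prec.trans (show Γ.Prec w e.term from h) ((show e'.init = e.term from he') ▸ e'.prec)

theorem level_of_mem_outEdges {e e' : Γ.Edge} (he' : e' ∈ Γ.outEdges e.term) :
    e'.level = e.level + 1 := by
  rw [Edge.level, show e'.init = e.term from he', e.gen_term]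

/-- The edges of a branch, counted from the edge terminating at `w`, in the `n`-th level. -/
def branchLevel (Γ : RootedGraphTree V) (w : V) (n : ℕ) : Set Γ.Edge :=
  {e | e ∈ Γ.branch w ∧ Γ.gen e.term = Γ.gen w + n}

theorem branchLevel_zero (a : Γ.Edge) : Γ.branchLevel a.term 0 = {a} := by
  ext e
  constructor
  · rintro ⟨h1, h2⟩
    rw [a.gen_term, e.gen_term] at h2
    exact eq_of_mem_branch_of_level_eq h1 (by omega)
  · rintro rfl
    exact ⟨prec_refl _, rfl⟩

/-- The next level consists of the edges emanating from the terminal vertices of a level. -/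
def branchLevelSuccEquiv (Γ : RootedGraphTree V) (a : Γ.Edge) (n : ℕ) :
    Γ.branchLevel a.term (n + 1) ≃ Σ f : Γ.branchLevel a.term n, Γ.outEdges f.1.term :=
  Equiv.symm <| Equiv.ofBijective
    (fun p => ⟨p.2.1, mem_branch_of_mem_outEdges p.1.2.1 p.2.2, by
      rw [p.2.1.gen_term, level_of_mem_outEdges p.2.2, ← p.1.1.gen_term, p.1.2.2]; omega⟩) <| by
    constructor
    · rintro ⟨⟨f, hf⟩, ⟨e, he⟩⟩ ⟨⟨f', hf'⟩, ⟨e', he'⟩⟩ h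
      obtain rfl : e = e' := congrArg Subtype.val h
      have h1 : e.init = f.term := he
      have h2 : e.init = f'.term := he'
      obtain rfl : f = f' := Edge.term_injective (h1.symm.trans h2)
      rfl
    · rintro ⟨e, he, hg⟩
      have h1 : Γ.Prec a.term e.init := by
        refine (mem_branch_term_iff.1 he).resolve_left ?_
        rintro rfl
        omega
      have h2 : e.init ≠ Γ.root := by
        intro h
        rw [h, prec_root_iff] at h1
        exact a.term_ne_root h1
      obtain ⟨f, hf⟩ := exists_edge_term h2
      refine ⟨⟨⟨f, ?_, ?_⟩, ⟨e, hf.symm⟩⟩, rfl⟩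
      · change Γ.Prec _ _; rw [hf]; exact h1
      · rw [hf]
        have := e.gen_term
        unfold Edge.level at this
        omega

/-- If the branching numbers of two branches agree level by level, so do the numbers of edges. -/
theorem nonempty_branchLevel_equiv {V' : Type*} {Γ' : RootedGraphTree V'} (a : Γ.Edge)
    (a' : Γ'.Edge)
    (h : ∀ e ∈ Γ.branch a.term, ∀ e' ∈ Γ'.branch a'.term,
      e.level + a'.level = e'.level + a.level → Γ.branching e.term = Γ'.branching e'.term)
    (n : ℕ) : Nonempty (Γ.branchLevel a.term n ≃ Γ'.branchLevel a'.term n) := by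
  induction n with
  | zero =>
    rw [branchLevel_zero, branchLevel_zero]
    exact ⟨Equiv.ofUnique _ _⟩
  | succ n ih =>
    obtain ⟨φ⟩ := ih
    have key : ∀ f : Γ.branchLevel a.term n,
        Nonempty (Γ.outEdges f.1.term ≃ Γ'.outEdges (φ f).1.term) := by
      intro f
      have : Finite (Γ.outEdges f.1.term) := Γ.outEdges_finite _
      have : Finite (Γ'.outEdges (φ f).1.term) := Γ'.outEdges_finite _
      refine Finite.card_eq.1 (h _ f.2.1 _ (φ f).2.1 ?_)
      have h1 := f.2.2
      have h2 := (φ f).2.2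
      rw [Edge.gen_term, Edge.gen_term] at h1 h2
      omega
    exact ⟨(branchLevelSuccEquiv Γ a n).trans
      ((Equiv.sigmaCongr φ fun f => (key f).some).trans (branchLevelSuccEquiv Γ' a' n).symm)⟩

theorem nonempty_branch_fiber_equiv (a : Γ.Edge) (n : ℕ) :
    Nonempty ({e : Γ.branch a.term // e.1.level - a.level = n} ≃ Γ.branchLevel a.term n) := by
  refine ⟨(Equiv.subtypeSubtypeEquivSubtypeInter (fun e => e ∈ Γ.branch a.term)
    (fun e => e.level - a.level = n)).trans (Equiv.subtypeEquivRight fun e => ?_)⟩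
  refine and_congr_right fun he => ?_
  have := level_le_of_mem_branch he
  rw [e.gen_term, a.gen_term]
  omega

/-- Branches with the same branching numbers are in a level-preserving bijection. -/
theorem exists_branch_equiv {V' : Type*} {Γ' : RootedGraphTree V'} (a : Γ.Edge)
    (a' : Γ'.Edge)
    (h : ∀ e ∈ Γ.branch a.term, ∀ e' ∈ Γ'.branch a'.term,
      e.level + a'.level = e'.level + a.level → Γ.branching e.term = Γ'.branching e'.term) :
    ∃ φ : Γ.branch a.term ≃ Γ'.branch a'.term,
      ∀ e, e.1.level + a'.level = (φ e).1.level + a.level := by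
  have hfib : ∀ n, Nonempty
      ({e : Γ.branch a.term // e.1.level - a.level = n} ≃
        {e : Γ'.branch a'.term // e.1.level - a'.level = n}) := by
    intro n
    obtain ⟨φ⟩ := nonempty_branchLevel_equiv a a' h n
    obtain ⟨ψ⟩ := nonempty_branch_fiber_equiv a n
    obtain ⟨ψ'⟩ := nonempty_branch_fiber_equiv a' n
    exact ⟨ψ.trans (φ.trans ψ'.symm)⟩
  refine ⟨Equiv.ofFiberEquiv (f := fun e : Γ.branch a.term => e.1.level - a.level)
    (g := fun e : Γ'.branch a'.term => e.1.level - a'.level) fun n => (hfib n).some, fun e => ?_⟩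
  have h1 := Equiv.ofFiberEquiv_map (f := fun e : Γ.branch a.term => e.1.level - a.level)
    (g := fun e : Γ'.branch a'.term => e.1.level - a'.level) (fun n => (hfib n).some) e
  have h2 := level_le_of_mem_branch e.2
  have h3 := level_le_of_mem_branch (Equiv.ofFiberEquiv
    (f := fun e : Γ.branch a.term => e.1.level - a.level)
    (g := fun e : Γ'.branch a'.term => e.1.level - a'.level) (fun n => (hfib n).some) e).2
  omega

end RootedGraphTree

/-! ### Heights and lengths in a regular tree -/

namespace MetricTree

open RootedGraphTree

variable {V V' : Type*} {Γ : MetricTree V} {Γ' : MetricTree V'}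

theorem height_term (e : Γ.Edge) : Γ.height e.term = Γ.height e.init + Γ.len e := by
  have h : {e' : Γ.Edge | Γ.Prec e'.term e.term} =
      insert e {e' : Γ.Edge | Γ.Prec e'.term e.init} := by
    ext e'
    simp only [Set.mem_ofPred_eq, Set.mem_insert_iff, e.prec_term_iff]
    exact or_congr_left ⟨fun h => Edge.term_injective h, fun h => h ▸ rfl⟩
  unfold height
  have hfin : {e' : Γ.Edge | Γ.Prec e'.term e.init}.Finite := finite_setOf_prec_term e.init
  have hmem : e ∉ {e' : Γ.Edge | Γ.Prec e'.term e.init} := not_prec_term_init e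
  rw [h, finsum_mem_insert _ hmem hfin, add_comm]

variable {b : ℕ → ℕ} {t : ℕ → ℝ}

theorem IsRegular.len_eq (h : Γ.IsRegular b t) (e : Γ.Edge) :
    Γ.len e = t (e.level + 1) - t e.level := by
  have h1 := height_term e
  rw [h.height_eq, h.height_eq, e.gen_term] at h1
  exact (sub_eq_of_eq_add' h1).symm

theorem IsRegular.branching_pos (h : Γ.IsRegular b t) (x : V) : 0 < Γ.branching x := by
  rw [h.branching_eq]
  rcases Nat.eq_zero_or_pos (Γ.gen x) with h0 | h0
  · rw [h0, h.b_zero]; exact one_pos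
  · exact lt_of_lt_of_le two_pos (h.two_le_b _ h0)

theorem IsRegular.exists_outEdge (h : Γ.IsRegular b t) (x : V) : ∃ e, e ∈ Γ.outEdges x :=
  Set.nonempty_of_ncard_ne_zero (h.branching_pos x).ne'

theorem IsRegular.exists_level_eq (h : Γ.IsRegular b t) (n : ℕ) : ∃ e : Γ.Edge, e.level = n := by
  induction n with
  | zero =>
    obtain ⟨e, he⟩ := h.exists_outEdge Γ.root
    exact ⟨e, by rw [Edge.level, show e.init = Γ.root from he, gen_root]⟩
  | succ n ih =>
    obtain ⟨e, rfl⟩ := ih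
    obtain ⟨e', he'⟩ := h.exists_outEdge e.term
    exact ⟨e', level_of_mem_outEdges he'⟩

theorem IsRegular.strictMono (h : Γ.IsRegular b t) : StrictMono t := by
  refine strictMono_nat_of_lt_succ fun n => ?_
  obtain ⟨e, rfl⟩ := h.exists_level_eq n
  exact sub_pos.1 (h.len_eq e ▸ Γ.len_pos e)

theorem IsRegular.norm_eq (h : Γ.IsRegular b t) (x : Γ.Coord) :
    Γ.norm x = t x.1.level + x.2 := by
  rw [norm, h.height_eq, Edge.level]

/-- The distance from the root determines the level and the position on the edge. -/
theorem IsRegular.level_eq_of_norm_eq (h : Γ.IsRegular b t) {x y : Γ.Coord} (hx : x ∈ Γ.points)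
    (hy : y ∈ Γ.points) (hxy : Γ.norm x = Γ.norm y) : x.1.level = y.1.level ∧ x.2 = y.2 := by
  have aux : ∀ {x y : Γ.Coord}, x ∈ Γ.points → y ∈ Γ.points → Γ.norm x = Γ.norm y →
      x.1.level ≤ y.1.level := by
    intro x y hx hy hxy
    by_contra! hlt
    have h1 := h.strictMono.monotone (Nat.succ_le_of_lt hlt)
    have h2 := hy.2
    have h3 := hx.1
    rw [h.norm_eq, h.norm_eq] at hxy
    rw [h.len_eq] at h2
    simp only [Nat.succ_eq_add_one] at h1
    linarith
  have hl := le_antisymm (aux hx hy hxy) (aux hy hx hxy.symm)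
  refine ⟨hl, ?_⟩
  rw [h.norm_eq, h.norm_eq, hl] at hxy
  exact add_left_cancel hxy

theorem edgeMeasure_congr {e : Γ.Edge} {e' : Γ'.Edge} (h : Γ.len e = Γ'.len e') :
    Γ.edgeMeasure e = Γ'.edgeMeasure e' := by
  rw [edgeMeasure, edgeMeasure, h]

/-! ### Functions in `L²(Γ)`, edge by edge -/

theorem measurable_coord {f : Γ.Coord → ℂ} (h : ∀ e, Measurable fun s : ℝ => f ⟨e, s⟩) :
    Measurable f := by
  intro s hs
  exact MeasurableSpace.measurableSet_iInf.2 fun e => h e hs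

theorem ae_iff_edges {p : Γ.Coord → Prop} (hp : MeasurableSet {x | p x}) :
    (∀ᵐ x ∂Γ.measure, p x) ↔ ∀ e, ∀ᵐ s ∂Γ.edgeMeasure e, p ⟨e, s⟩ :=
  (Measure.ae_sum_iff' hp).trans <| forall_congr' fun e =>
    ae_map_iff (Γ.measurable_mk e).aemeasurable hp

theorem L2.measurable (u : Γ.L2) : Measurable u := (Lp.stronglyMeasurable u).measurable

theorem L2.ext_edges {u w : Γ.L2} (h : ∀ e, ∀ᵐ s ∂Γ.edgeMeasure e, u ⟨e, s⟩ = w ⟨e, s⟩) :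
    u = w :=
  Lp.ext ((ae_iff_edges (measurableSet_eq_fun (L2.measurable u) (L2.measurable w))).2 h)

theorem L2.coeFn_add_edge (u w : Γ.L2) (e : Γ.Edge) :
    ∀ᵐ s ∂Γ.edgeMeasure e, (u + w) ⟨e, s⟩ = u ⟨e, s⟩ + w ⟨e, s⟩ :=
  Γ.ae_edge (Lp.coeFn_add u w) e

theorem L2.coeFn_smul_edge (a : ℂ) (u : Γ.L2) (e : Γ.Edge) :
    ∀ᵐ s ∂Γ.edgeMeasure e, (a • u) ⟨e, s⟩ = a * u ⟨e, s⟩ :=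
  Γ.ae_edge (Lp.coeFn_smul a u) e

theorem L2.coeFn_zero_edge (e : Γ.Edge) :
    ∀ᵐ s ∂Γ.edgeMeasure e, (0 : Γ.L2) ⟨e, s⟩ = 0 :=
  Γ.ae_edge (Lp.coeFn_zero ℂ 2 Γ.measure) e

theorem L2.coeFn_sum_edge {ι : Type*} (s : Finset ι) (u : ι → Γ.L2) (e : Γ.Edge) :
    ∀ᵐ x ∂Γ.edgeMeasure e, (∑ i ∈ s, u i) ⟨e, x⟩ = ∑ i ∈ s, u i ⟨e, x⟩ := by
  classical
  induction s using Finset.induction_on with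
  | empty => simpa using L2.coeFn_zero_edge e
  | insert i s hi ih =>
    rw [Finset.sum_insert hi]
    filter_upwards [L2.coeFn_add_edge (u i) (∑ i ∈ s, u i) e, ih] with x h1 h2
    rw [h1, h2, Finset.sum_insert hi]

theorem lintegral_measure {f : Γ.Coord → ENNReal} (hf : Measurable f) :
    ∫⁻ x, f x ∂Γ.measure = ∑' e, ∫⁻ s, f ⟨e, s⟩ ∂Γ.edgeMeasure e := by
  rw [measure, lintegral_sum_measure]
  exact tsum_congr fun e => lintegral_map hf (Γ.measurable_mk e)

theorem L2.inner_eq_tsum (u w : Γ.L2) :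
    inner ℂ u w = ∑' e, ∫ s, inner ℂ (u ⟨e, s⟩) (w ⟨e, s⟩) ∂Γ.edgeMeasure e := by
  rw [MeasureTheory.L2.inner_def]
  have hint := MeasureTheory.L2.integrable_inner (𝕜 := ℂ) u w
  have hm : Measurable fun x => inner ℂ (u x) (w x) :=
    (L2.measurable u).inner (L2.measurable w)
  have hsum := hasSum_integral_measure
    (μ := fun e => (Γ.edgeMeasure e).map (Sigma.mk e)) hint
  refine hsum.tsum_eq.symm.trans (tsum_congr fun e => ?_)
  exact integral_map (Γ.measurable_mk e).aemeasurable hm.aestronglyMeasurable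

/-! ### Transfer of functions between trees along partial bijections of the edges -/

/-- A bijection between a set of edges of `Γ` and a set of edges of `Γ'` which preserves the
lengths. No compatibility with the incidence relations is required. -/
structure EdgeMatch (Γ : MetricTree V) (Γ' : MetricTree V') where
  /-- the partial bijection -/
  toPEquiv : Γ.Edge ≃. Γ'.Edge
  len_eq : ∀ {e e'}, e' ∈ toPEquiv e → Γ.len e = Γ'.len e'

namespace EdgeMatch

variable (p : EdgeMatch Γ Γ')

/-- The inverse partial bijection. -/
def symm : EdgeMatch Γ' Γ where
  toPEquiv := p.toPEquiv.symm
  len_eq h := (p.len_eq (p.toPEquiv.mem_iff_mem.1 h)).symm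

theorem mem_symm {e : Γ.Edge} {e' : Γ'.Edge} :
    e ∈ p.symm.toPEquiv e' ↔ e' ∈ p.toPEquiv e := p.toPEquiv.mem_iff_mem

/-- The function on `Γ` which is obtained from a function on `Γ'` by moving it along `p`, extended
by zero to the edges without partner. -/
def pullFun {R : Type*} [Zero R] (u : Γ'.Edge → ℝ → R) (e : Γ.Edge) (s : ℝ) : R :=
  (p.toPEquiv e).elim 0 fun e' => u e' s

theorem pullFun_of_mem {R : Type*} [Zero R] {u : Γ'.Edge → ℝ → R} {e : Γ.Edge} {e' : Γ'.Edge}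
    (h : e' ∈ p.toPEquiv e) (s : ℝ) : p.pullFun u e s = u e' s := by
  rw [pullFun, Option.mem_def.1 h]; rfl

theorem pullFun_of_eq_none {R : Type*} [Zero R] {u : Γ'.Edge → ℝ → R} {e : Γ.Edge}
    (h : p.toPEquiv e = none) (s : ℝ) : p.pullFun u e s = 0 := by
  rw [pullFun, h]; rfl

theorem measurable_pullFun {R : Type*} [Zero R] [MeasurableSpace R] {u : Γ'.Edge → ℝ → R}
    (hu : ∀ e, Measurable (u e)) (e : Γ.Edge) : Measurable (p.pullFun u e) := by
  rcases h : p.toPEquiv e with _ | e'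
  · have : p.pullFun u e = fun _ => 0 := funext (p.pullFun_of_eq_none h)
    rw [this]; exact measurable_const
  · have : p.pullFun u e = u e' := funext (p.pullFun_of_mem h)
    rw [this]; exact hu e'

theorem memLp_pullFun (u : Γ'.L2) :
    MemLp (fun x : Γ.Coord => p.pullFun (fun e s => u ⟨e, s⟩) x.1 x.2) 2 Γ.measure := by
  have hmeas : ∀ e, Measurable fun s => u ⟨e, s⟩ := fun e =>
    (L2.measurable u).comp (Γ'.measurable_mk e)
  have hm : Measurable fun x : Γ.Coord => p.pullFun (fun e s => u ⟨e, s⟩) x.1 x.2 :=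
    measurable_coord fun e => p.measurable_pullFun hmeas e
  refine ⟨hm.aestronglyMeasurable, ?_⟩
  have hu := (Lp.memLp u).2
  rw [eLpNorm_lt_top_iff_lintegral_rpow_enorm_lt_top two_ne_zero ENNReal.ofNat_ne_top] at hu ⊢
  rw [lintegral_measure ((L2.measurable u).enorm.pow_const _)] at hu
  rw [lintegral_measure (hm.enorm.pow_const _)]
  refine lt_of_le_of_lt ?_ hu
  -- only the edges with a partner contribute, and the partners are distinct
  let D : Set Γ.Edge := {e | (p.toPEquiv e).isSome}
  let q : D → Γ'.Edge := fun e => (p.toPEquiv e.1).get e.2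
  have hq : ∀ e : D, q e ∈ p.toPEquiv e.1 := fun e => Option.get_mem e.2
  have hinj : Function.Injective q := fun e e' h =>
    Subtype.ext (p.toPEquiv.inj (hq e) (h ▸ hq e'))
  refine le_trans (le_of_eq ?_) (ENNReal.tsum_comp_le_tsum_of_injective hinj _)
  rw [← tsum_subtype_eq_of_support_subset (s := D)]
  · refine tsum_congr fun e => ?_
    rw [edgeMeasure_congr (p.len_eq (hq e))]
    exact lintegral_congr fun s => by rw [p.pullFun_of_mem (hq e)]
  · intro e he
    by_contra hD
    refine he ?_
    have h0 : p.toPEquiv e = none := by simpa [D] using hD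
    simp [p.pullFun_of_eq_none h0]

/-- The transfer operator `L²(Γ') → L²(Γ)` along a partial bijection of the edges. -/
def transfer : Γ'.L2 →ₗ[ℂ] Γ.L2 where
  toFun u := (p.memLp_pullFun u).toLp
  map_add' u w := by
    refine L2.ext_edges fun e => ?_
    filter_upwards [Γ.ae_edge (p.memLp_pullFun (u + w)).coeFn_toLp e,
      L2.coeFn_add_edge (p.memLp_pullFun u).toLp (p.memLp_pullFun w).toLp e,
      Γ.ae_edge (p.memLp_pullFun u).coeFn_toLp e, Γ.ae_edge (p.memLp_pullFun w).coeFn_toLp e,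
      show ∀ᵐ s ∂Γ.edgeMeasure e, p.pullFun (fun e s => (u + w) ⟨e, s⟩) e s =
        p.pullFun (fun e s => u ⟨e, s⟩) e s + p.pullFun (fun e s => w ⟨e, s⟩) e s by
          rcases h : p.toPEquiv e with _ | e'
          · simp [p.pullFun_of_eq_none h]
          · simp only [p.pullFun_of_mem h]
            rw [edgeMeasure_congr (p.len_eq h)]
            exact L2.coeFn_add_edge u w e'] with s h1 h2 h3 h4 h5
    rw [h1, h2, h3, h4, h5]
  map_smul' a u := by
    refine L2.ext_edges fun e => ?_
    simp only [RingHom.id_apply]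
    filter_upwards [Γ.ae_edge (p.memLp_pullFun (a • u)).coeFn_toLp e,
      L2.coeFn_smul_edge a (p.memLp_pullFun u).toLp e,
      Γ.ae_edge (p.memLp_pullFun u).coeFn_toLp e,
      show ∀ᵐ s ∂Γ.edgeMeasure e, p.pullFun (fun e s => (a • u) ⟨e, s⟩) e s =
        a * p.pullFun (fun e s => u ⟨e, s⟩) e s by
          rcases h : p.toPEquiv e with _ | e'
          · simp [p.pullFun_of_eq_none h]
          · simp only [p.pullFun_of_mem h]
            rw [edgeMeasure_congr (p.len_eq h)]
            exact L2.coeFn_smul_edge a u e'] with s h1 h2 h3 h5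
    rw [h1, h2, h3, h5]

theorem transfer_of_mem (u : Γ'.L2) {e : Γ.Edge} {e' : Γ'.Edge} (h : e' ∈ p.toPEquiv e) :
    ∀ᵐ s ∂Γ.edgeMeasure e, p.transfer u ⟨e, s⟩ = u ⟨e', s⟩ := by
  filter_upwards [Γ.ae_edge (p.memLp_pullFun u).coeFn_toLp e] with s h1
  exact h1.trans (p.pullFun_of_mem h s)

theorem transfer_of_eq_none (u : Γ'.L2) {e : Γ.Edge} (h : p.toPEquiv e = none) :
    ∀ᵐ s ∂Γ.edgeMeasure e, p.transfer u ⟨e, s⟩ = 0 := by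
  filter_upwards [Γ.ae_edge (p.memLp_pullFun u).coeFn_toLp e] with s h1
  exact h1.trans (p.pullFun_of_eq_none h s)

/-- The transfer along the inverse partial bijection is the adjoint operator. -/
theorem inner_transfer (u : Γ'.L2) (w : Γ.L2) :
    inner ℂ (p.transfer u) w = inner ℂ u (p.symm.transfer w) := by
  rw [L2.inner_eq_tsum, L2.inner_eq_tsum]
  have h0 : ∀ e, p.toPEquiv e = none →
      ∫ s, inner ℂ (p.transfer u ⟨e, s⟩) (w ⟨e, s⟩) ∂Γ.edgeMeasure e = 0 := by
    intro e he
    refine integral_eq_zero_of_ae ?_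
    filter_upwards [p.transfer_of_eq_none u he] with s hs
    rw [hs, inner_zero_left]; rfl
  have h0' : ∀ e', p.symm.toPEquiv e' = none →
      ∫ s, inner ℂ (u ⟨e', s⟩) (p.symm.transfer w ⟨e', s⟩) ∂Γ'.edgeMeasure e' = 0 := by
    intro e' he
    refine integral_eq_zero_of_ae ?_
    filter_upwards [p.symm.transfer_of_eq_none w he] with s hs
    rw [hs, inner_zero_right]; rfl
  have hex : ∀ e : Function.support fun e' => ∫ s, inner ℂ (u ⟨e', s⟩)
      (p.symm.transfer w ⟨e', s⟩) ∂Γ'.edgeMeasure e', ∃ e0, e0 ∈ p.symm.toPEquiv e.1 := fun e =>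
    Option.ne_none_iff_exists'.1 fun h => e.2 (h0' _ h)
  choose i hi using hex
  refine tsum_eq_tsum_of_ne_zero_bij i (fun e e' h => ?_) ?_ fun e => ?_
  · exact Subtype.ext (p.symm.toPEquiv.inj (hi e) (h ▸ hi e'))
  · intro e he
    obtain ⟨e', he'⟩ := Option.ne_none_iff_exists'.1 fun h => he (h0 e h)
    have heq : ∫ s, inner ℂ (p.transfer u ⟨e, s⟩) (w ⟨e, s⟩) ∂Γ.edgeMeasure e =
        ∫ s, inner ℂ (u ⟨e', s⟩) (p.symm.transfer w ⟨e', s⟩) ∂Γ'.edgeMeasure e' := by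
      have hm : Γ.edgeMeasure e = Γ'.edgeMeasure e' := edgeMeasure_congr (p.len_eq he')
      rw [← hm]
      refine integral_congr_ae ?_
      filter_upwards [p.transfer_of_mem u he',
        hm ▸ p.symm.transfer_of_mem w (p.mem_symm.2 he')] with s h1 h2
      rw [h1, h2]
    have hs : e' ∈ Function.support fun e' => ∫ s, inner ℂ (u ⟨e', s⟩)
        (p.symm.transfer w ⟨e', s⟩) ∂Γ'.edgeMeasure e' := by
      intro h
      exact he (heq.trans h)
    refine ⟨⟨e', hs⟩, ?_⟩
    have := hi ⟨e', hs⟩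
    rw [Option.mem_def, Option.mem_def.1 (p.mem_symm.2 he')] at this
    exact (Option.some_injective _ this).symm
  · have he' := p.mem_symm.1 (hi e)
    have hm : Γ.edgeMeasure (i e) = Γ'.edgeMeasure e := edgeMeasure_congr (p.len_eq he')
    rw [hm]
    refine integral_congr_ae ?_
    filter_upwards [hm ▸ p.transfer_of_mem u he', p.symm.transfer_of_mem w (hi e)] with s h1 h2
    rw [h1, h2]

/-- The transfer operators respect weak derivatives. -/
theorem isWeakDeriv_transfer {u u' : Γ'.L2} (h : Γ'.IsWeakDeriv u u') :
    Γ.IsWeakDeriv (p.transfer u) (p.transfer u') := by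
  intro e φ h1 h2 h3
  rcases he : p.toPEquiv e with _ | e'
  · have key : ∀ (ψ : ℝ → ℝ) (w : Γ'.L2),
        ∫ s, ψ s • p.transfer w ⟨e, s⟩ ∂Γ.edgeMeasure e = 0 := by
      intro ψ w
      refine integral_eq_zero_of_ae ?_
      filter_upwards [p.transfer_of_eq_none w he] with s hs
      rw [hs, smul_zero]; rfl
    rw [key, key, neg_zero]
  · have hl := p.len_eq he
    have key : ∀ (ψ : ℝ → ℝ) (w : Γ'.L2), ∫ s, ψ s • p.transfer w ⟨e, s⟩ ∂Γ.edgeMeasure e =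
        ∫ s, ψ s • w ⟨e', s⟩ ∂Γ'.edgeMeasure e' := by
      intro ψ w
      rw [← edgeMeasure_congr hl]
      refine integral_congr_ae ?_
      filter_upwards [p.transfer_of_mem w he] with s hs
      rw [hs]
    rw [key, key]
    exact h e' φ h1 h2 (hl ▸ h3)

end EdgeMatch

theorem IsWeakDeriv.sum {ι : Type*} {s : Finset ι} {u u' : ι → Γ.L2}
    (h : ∀ i ∈ s, Γ.IsWeakDeriv (u i) (u' i)) :
    Γ.IsWeakDeriv (∑ i ∈ s, u i) (∑ i ∈ s, u' i) := by
  classical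
  induction s using Finset.induction_on with
  | empty => simpa using IsWeakDeriv.zero Γ
  | insert i s hi ih =>
    rw [Finset.sum_insert hi, Finset.sum_insert hi]
    exact (h i (Finset.mem_insert_self _ _)).add
      (ih fun j hj => h j (Finset.mem_insert_of_mem hj))

theorem IsWeakDeriv.unique {u u' u'' : Γ.L2} (h : Γ.IsWeakDeriv u u')
    (h' : Γ.IsWeakDeriv u u'') : u' = u'' := by
  have h0 := h.add (h'.smul (-1))
  rw [neg_one_smul, neg_one_smul, add_neg_cancel] at h0
  exact add_neg_eq_zero.1 h0.eq_zero

end MetricTree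

/-! ### Symmetric functions, edge by edge -/

namespace MetricTree

open RootedGraphTree

variable {V V' : Type*} {Γ : MetricTree V} {Γ' : MetricTree V'} {b b' : ℕ → ℕ} {t t' : ℕ → ℝ}

/-- A function is symmetric on the union of the edges in `E` if and only if it vanishes on the other
edges and agrees on any two edges of `E` of the same level. -/
theorem IsRegular.mem_symmetricOn_iff (h : Γ.IsRegular b t) (E : Set Γ.Edge) (u : Γ.L2) :
    u ∈ Γ.symmetricOn {x | x ∈ Γ.points ∧ x.1 ∈ E} ↔
      (∀ e ∉ E, ∀ᵐ s ∂Γ.edgeMeasure e, u ⟨e, s⟩ = 0) ∧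
      ∀ e ∈ E, ∀ e' ∈ E, e.level = e'.level →
        ∀ᵐ s ∂Γ.edgeMeasure e, u ⟨e, s⟩ = u ⟨e', s⟩ := by
  have hpt : ∀ e : Γ.Edge, ∀ᵐ s ∂Γ.edgeMeasure e, (⟨e, s⟩ : Γ.Coord) ∈ Γ.points := fun e =>
    (ae_restrict_mem measurableSet_Ioo).mono fun _ hs => hs
  have hl : ∀ e e' : Γ.Edge, e.level = e'.level → Γ.len e = Γ.len e' := fun e e' he => by
    rw [h.len_eq, h.len_eq, he]
  constructor
  · rintro ⟨g, h1, h2, h3⟩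
    refine ⟨fun e he => ?_, fun e he e' he' hee => ?_⟩
    · filter_upwards [Γ.ae_edge h1 e, hpt e] with s hs hs'
      rw [hs]
      exact h2 _ hs' fun hT => he hT.2
    · have hm := edgeMeasure_congr (hl e e' hee)
      have h4 := Γ.ae_edge h1 e'
      have h5 := hpt e'
      rw [← hm] at h4 h5
      filter_upwards [Γ.ae_edge h1 e, hpt e, h4, h5] with s a1 a2 a3 a4
      rw [a1, a3]
      refine h3 _ ⟨a2, he⟩ _ ⟨a4, he'⟩ ?_
      rw [h.norm_eq, h.norm_eq, hee]
  · rintro ⟨h0, hs⟩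
    classical
    -- a reference edge in every level which meets `E`
    let ref : ℕ → Option Γ.Edge := fun n =>
      if hn : ∃ e ∈ E, e.level = n then some hn.choose else none
    have href : ∀ e ∈ E, ∃ e' ∈ E, e'.level = e.level ∧ ref e.level = some e' := by
      intro e he
      have hn : ∃ e' ∈ E, e'.level = e.level := ⟨e, he, rfl⟩
      exact ⟨hn.choose, hn.choose_spec.1, hn.choose_spec.2, dif_pos hn⟩
    let g : Γ.Coord → ℂ := fun x =>
      if x.1 ∈ E then (ref x.1.level).elim 0 fun e' => u ⟨e', x.2⟩ else 0
    have hgE : ∀ e ∈ E, ∃ e' ∈ E, e'.level = e.level ∧ ∀ s, g ⟨e, s⟩ = u ⟨e', s⟩ := by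
      intro e he
      obtain ⟨e', he', hle, hr⟩ := href e he
      refine ⟨e', he', hle, fun s => ?_⟩
      simp only [g, if_pos he, hr]
      rfl
    have hg0 : ∀ e ∉ E, ∀ s, g ⟨e, s⟩ = 0 := fun e he s => if_neg he
    have hgm : Measurable g := by
      refine measurable_coord fun e => ?_
      by_cases he : e ∈ E
      · obtain ⟨e', -, -, hg⟩ := hgE e he
        rw [show (fun s => g ⟨e, s⟩) = fun s => u ⟨e', s⟩ from funext hg]
        exact (L2.measurable u).comp (Γ.measurable_mk e')
      · rw [show (fun s => g ⟨e, s⟩) = fun _ => 0 from funext (hg0 e he)]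
        exact measurable_const
    refine ⟨g, (ae_iff_edges (measurableSet_eq_fun (L2.measurable u) hgm)).2 fun e => ?_,
      fun x hx hT => hg0 x.1 (fun hE => hT ⟨hx, hE⟩) x.2, fun x hx y hy hxy => ?_⟩
    · by_cases he : e ∈ E
      · obtain ⟨e', he', hle, hg⟩ := hgE e he
        filter_upwards [hs e he e' he' hle.symm] with s hs
        rw [hs, hg]
      · filter_upwards [h0 e he] with s hs
        rw [hs, hg0 e he]
    · obtain ⟨h1, h2⟩ := h.level_eq_of_norm_eq hx.1 hy.1 hxy
      simp only [g, if_pos hx.2, if_pos hy.2, h1, h2]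

theorem IsRegular.mem_FSymm_iff (h : Γ.IsRegular b t) (u : Γ.L2) :
    u ∈ Γ.FSymm ↔ ∀ e e' : Γ.Edge, e.level = e'.level →
      ∀ᵐ s ∂Γ.edgeMeasure e, u ⟨e, s⟩ = u ⟨e', s⟩ := by
  have hT : Γ.points = {x | x ∈ Γ.points ∧ x.1 ∈ (Set.univ : Set Γ.Edge)} := by
    ext x; simp
  rw [FSymm, hT, h.mem_symmetricOn_iff]
  simp

theorem IsRegular.mem_FVertex_iff (h : Γ.IsRegular b t) (v : V) (u : Γ.L2) :
    u ∈ Γ.FVertex v ↔ (∀ e : Γ.Edge, ¬ Γ.Prec v e.init → ∀ᵐ s ∂Γ.edgeMeasure e, u ⟨e, s⟩ = 0) ∧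
      ∀ e e' : Γ.Edge, Γ.Prec v e.init → Γ.Prec v e'.init → e.level = e'.level →
        ∀ᵐ s ∂Γ.edgeMeasure e, u ⟨e, s⟩ = u ⟨e', s⟩ := by
  have hT : Γ.vertexSubtree v =
      {x | x ∈ Γ.points ∧ x.1 ∈ {e : Γ.Edge | Γ.Prec v e.init}} := rfl
  rw [FVertex, hT, h.mem_symmetricOn_iff]
  exact and_congr_right fun _ =>
    ⟨fun h e e' he he' => h e he e' he', fun h e he e' he' => h e e' he he'⟩

theorem IsRegular.mem_FEdge_iff (h : Γ.IsRegular b t) (a : Γ.Edge) (u : Γ.L2) :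
    u ∈ Γ.FEdge a ↔ (∀ e ∉ Γ.branch a.term, ∀ᵐ s ∂Γ.edgeMeasure e, u ⟨e, s⟩ = 0) ∧
      ∀ e ∈ Γ.branch a.term, ∀ e' ∈ Γ.branch a.term, e.level = e'.level →
        ∀ᵐ s ∂Γ.edgeMeasure e, u ⟨e, s⟩ = u ⟨e', s⟩ := by
  have hT : Γ.edgeSubtree a = {x | x ∈ Γ.points ∧ x.1 ∈ Γ.branch a.term} := by
    ext x
    have h1 := mem_branch_term_iff (a := a) (e := x.1)
    simp only [edgeSubtree, vertexSubtree, Set.mem_union, Set.mem_ofPred_eq, h1]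
    tauto
  rw [FEdge, hT, h.mem_symmetricOn_iff]

/-! ### Identification of the branches at a vertex with a smaller tree -/

instance (v : V) : Fintype (Γ.outEdges v) := (Γ.outEdges_finite v).fintype

theorem card_outEdges (v : V) : Fintype.card (Γ.outEdges v) = Γ.branching v :=
  (Nat.card_eq_fintype_card).symm

/-- For every edge `a` emanating from `v` a bijection between the edges of the subtree `T_a` and
all the edges of `Γ'` which preserves the lengths and shifts the levels by `gen v`. Adjacent edges
need not be sent to adjacent edges: for symmetric functions only the levels matter. -/
structure BranchMatch (Γ : MetricTree V) (Γ' : MetricTree V') (v : V) where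
  /-- the bijection for the edge `a` -/
  edgeMatch : Γ.outEdges v → EdgeMatch Γ Γ'
  exists_mem_iff : ∀ a e, (∃ e', e' ∈ (edgeMatch a).toPEquiv e) ↔ e ∈ Γ.branch a.1.term
  exists_mem : ∀ a e', ∃ e, e' ∈ (edgeMatch a).toPEquiv e
  level_eq : ∀ {a e e'}, e' ∈ (edgeMatch a).toPEquiv e → e.level = Γ.gen v + e'.level

theorem IsRegular.level_zero_unique (h : Γ.IsRegular b t) {e e' : Γ.Edge} (he : e.level = 0)
    (he' : e'.level = 0) : e = e' := by
  have hc : (Γ.outEdges Γ.root).ncard = 1 := by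
    rw [← branching, h.branching_eq, gen_root, h.b_zero]
  obtain ⟨a, ha⟩ := Set.ncard_eq_one.1 hc
  have h1 : e ∈ Γ.outEdges Γ.root := eq_root_of_gen_eq_zero he
  have h2 : e' ∈ Γ.outEdges Γ.root := eq_root_of_gen_eq_zero he'
  rw [ha] at h1 h2
  exact h1.trans h2.symm

/-- The whole of a regular tree is one branch, as only one edge emanates from the root. -/
theorem IsRegular.mem_branch_of_level_eq_zero (h : Γ.IsRegular b t) {a : Γ.Edge}
    (ha : a.level = 0) (e : Γ.Edge) : e ∈ Γ.branch a.term := by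
  obtain ⟨a', ha', he⟩ := exists_mem_branch (prec_root e.init)
  have h0 : a'.level = 0 := by rw [Edge.level, show a'.init = Γ.root from ha', gen_root]
  rwa [h.level_zero_unique ha h0]

/-- A bijection between sets of edges as a partial bijection. -/
def _root_.PEquiv.ofSetEquiv {α β : Type*} {s : Set α} {r : Set β} (φ : s ≃ r) : α ≃. β where
  toFun x := open Classical in if h : x ∈ s then some (φ ⟨x, h⟩).1 else none
  invFun y := open Classical in if h : y ∈ r then some (φ.symm ⟨y, h⟩).1 else none
  inv x y := by
    classical
    constructor
    · intro h
      by_cases hy : y ∈ r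
      · simp only [dif_pos hy, Option.some.injEq] at h
        subst h
        simp
      · simp [dif_neg hy] at h
    · intro h
      by_cases hx : x ∈ s
      · simp only [dif_pos hx, Option.some.injEq] at h
        subst h
        simp
      · simp [dif_neg hx] at h

theorem _root_.PEquiv.mem_ofSetEquiv_iff {α β : Type*} {s : Set α} {r : Set β} (φ : s ≃ r) {x : α}
    {y : β} : y ∈ PEquiv.ofSetEquiv φ x ↔ ∃ h : x ∈ s, (φ ⟨x, h⟩).1 = y := by
  classical
  change y ∈ (if h : x ∈ s then some (φ ⟨x, h⟩).1 else none) ↔ _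
  by_cases hx : x ∈ s <;> simp [hx]

theorem exists_branchMatch (h : Γ.IsRegular b t) (h' : Γ'.IsRegular b' t') (v : V)
    (hb : ∀ n, 0 < n → b (Γ.gen v + n) = b' n)
    (ht : ∀ n, t (Γ.gen v + (n + 1)) - t (Γ.gen v + n) = t' (n + 1) - t' n) :
    Nonempty (BranchMatch Γ Γ' v) := by
  obtain ⟨a', ha'⟩ := h'.exists_level_eq 0
  have hlev : ∀ a : Γ.outEdges v, a.1.level = Γ.gen v := fun a => by
    rw [Edge.level, show a.1.init = v from a.2]
  have key : ∀ a : Γ.outEdges v, ∃ φ : Γ.branch a.1.term ≃ Γ'.branch a'.term,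
      ∀ e, e.1.level + a'.level = (φ e).1.level + a.1.level := by
    intro a
    refine exists_branch_equiv a.1 a' fun e _ e' _ hl => ?_
    rw [ha', hlev, add_zero] at hl
    rw [← hb (e'.level + 1) (Nat.succ_pos _) |>.trans (congrArg b' e'.gen_term.symm)
      |>.trans (h'.branching_eq e'.term).symm, h.branching_eq, e.gen_term, hl]
    congr 1
    omega
  choose φ hφ using key
  have hφ' : ∀ a e, e.1.level = Γ.gen v + (φ a e).1.level := fun a e => by
    have := hφ a e
    rw [ha', hlev] at this
    omega
  refine ⟨{
    edgeMatch := fun a => ⟨PEquiv.ofSetEquiv (φ a), fun {e e'} he => ?_⟩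
    exists_mem_iff := fun a e => ?_
    exists_mem := fun a e' => ?_
    level_eq := fun {a e e'} he => ?_ }⟩
  · obtain ⟨h1, rfl⟩ := (PEquiv.mem_ofSetEquiv_iff _).1 he
    rw [h.len_eq, h'.len_eq, ← ht, show e.level = _ from hφ' a ⟨e, h1⟩]
    rfl
  · simp only [PEquiv.mem_ofSetEquiv_iff]
    exact ⟨fun ⟨_, h, _⟩ => h, fun h => ⟨_, h, rfl⟩⟩
  · refine ⟨(φ a).symm ⟨e', h'.mem_branch_of_level_eq_zero ha' e'⟩, ?_⟩
    exact (PEquiv.mem_ofSetEquiv_iff _).2 ⟨Subtype.coe_prop _, by simp⟩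
  · obtain ⟨h1, rfl⟩ := (PEquiv.mem_ofSetEquiv_iff _).1 he
    exact hφ' a ⟨e, h1⟩

namespace BranchMatch

variable {v : V} (M : BranchMatch Γ Γ' v)

/-- The isometry of `L²(Γ')` onto the functions on `Γ` which live on the subtree `T_a`. -/
def extend (a : Γ.outEdges v) : Γ'.L2 →ₗ[ℂ] Γ.L2 := (M.edgeMatch a).transfer

/-- The restriction of functions on `Γ` to the subtree `T_a`, seen as functions on `Γ'`. -/
def restrict (a : Γ.outEdges v) : Γ.L2 →ₗ[ℂ] Γ'.L2 := (M.edgeMatch a).symm.transfer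

theorem inner_extend (a : Γ.outEdges v) (u : Γ'.L2) (w : Γ.L2) :
    inner ℂ (M.extend a u) w = inner ℂ u (M.restrict a w) :=
  (M.edgeMatch a).inner_transfer u w

theorem eq_none {a : Γ.outEdges v} {e : Γ.Edge} (h : e ∉ Γ.branch a.1.term) :
    (M.edgeMatch a).toPEquiv e = none := by
  rw [← M.exists_mem_iff] at h
  exact Option.eq_none_iff_forall_not_mem.2 fun e' he' => h ⟨e', he'⟩

theorem mem_branch {a : Γ.outEdges v} {e : Γ.Edge} {e' : Γ'.Edge}
    (h : e' ∈ (M.edgeMatch a).toPEquiv e) : e ∈ Γ.branch a.1.term :=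
  (M.exists_mem_iff a e).1 ⟨e', h⟩

theorem extend_of_mem {a : Γ.outEdges v} {e : Γ.Edge} {e' : Γ'.Edge}
    (h : e' ∈ (M.edgeMatch a).toPEquiv e) (u : Γ'.L2) :
    ∀ᵐ s ∂Γ.edgeMeasure e, M.extend a u ⟨e, s⟩ = u ⟨e', s⟩ :=
  (M.edgeMatch a).transfer_of_mem u h

theorem extend_of_notMem {a : Γ.outEdges v} {e : Γ.Edge} (h : e ∉ Γ.branch a.1.term)
    (u : Γ'.L2) : ∀ᵐ s ∂Γ.edgeMeasure e, M.extend a u ⟨e, s⟩ = 0 :=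
  (M.edgeMatch a).transfer_of_eq_none u (M.eq_none h)

theorem edgeMeasure_eq {a : Γ.outEdges v} {e : Γ.Edge} {e' : Γ'.Edge}
    (h : e' ∈ (M.edgeMatch a).toPEquiv e) : Γ.edgeMeasure e = Γ'.edgeMeasure e' :=
  edgeMeasure_congr ((M.edgeMatch a).len_eq h)

theorem restrict_of_mem {a : Γ.outEdges v} {e : Γ.Edge} {e' : Γ'.Edge}
    (h : e' ∈ (M.edgeMatch a).toPEquiv e) (u : Γ.L2) :
    ∀ᵐ s ∂Γ'.edgeMeasure e', M.restrict a u ⟨e', s⟩ = u ⟨e, s⟩ :=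
  (M.edgeMatch a).symm.transfer_of_mem u ((M.edgeMatch a).mem_symm.2 h)

theorem restrict_extend (a : Γ.outEdges v) (u : Γ'.L2) : M.restrict a (M.extend a u) = u := by
  refine L2.ext_edges fun e' => ?_
  obtain ⟨e, he⟩ := M.exists_mem a e'
  have hm := M.edgeMeasure_eq he
  filter_upwards [M.restrict_of_mem he (M.extend a u), hm ▸ M.extend_of_mem he u] with s h1 h2
  rw [h1, h2]

theorem restrict_extend_of_ne {a a' : Γ.outEdges v} (h : a ≠ a') (u : Γ'.L2) :
    M.restrict a (M.extend a' u) = 0 := by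
  refine L2.ext_edges fun e' => ?_
  obtain ⟨e, he⟩ := M.exists_mem a e'
  have hm := M.edgeMeasure_eq he
  have hne : e ∉ Γ.branch a'.1.term := fun h' =>
    h (Subtype.ext (branch_disjoint a.2 a'.2 (M.mem_branch he) h'))
  filter_upwards [M.restrict_of_mem he (M.extend a' u), hm ▸ M.extend_of_notMem hne u,
    L2.coeFn_zero_edge (Γ := Γ') e'] with s h1 h2 h3
  rw [h1, h2, h3]

theorem restrict_sum_extend (u : Γ.outEdges v → Γ'.L2) (a : Γ.outEdges v) :
    M.restrict a (∑ a', M.extend a' (u a')) = u a := by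
  rw [map_sum, Finset.sum_eq_single a, M.restrict_extend]
  · exact fun a' _ h => M.restrict_extend_of_ne h.symm _
  · exact fun h => (h (Finset.mem_univ a)).elim

theorem sum_extend_of_mem {a : Γ.outEdges v} {e : Γ.Edge} {e' : Γ'.Edge}
    (h : e' ∈ (M.edgeMatch a).toPEquiv e) (u : Γ.outEdges v → Γ'.L2) :
    ∀ᵐ s ∂Γ.edgeMeasure e, (∑ a, M.extend a (u a)) ⟨e, s⟩ = u a ⟨e', s⟩ := by
  have h1 := M.restrict_of_mem h (∑ a, M.extend a (u a))
  rw [M.restrict_sum_extend, ← M.edgeMeasure_eq h] at h1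
  filter_upwards [h1] with s hs using hs.symm

theorem sum_extend_of_not_prec {e : Γ.Edge} (h : ¬ Γ.Prec v e.init)
    (u : Γ.outEdges v → Γ'.L2) :
    ∀ᵐ s ∂Γ.edgeMeasure e, (∑ a, M.extend a (u a)) ⟨e, s⟩ = 0 := by
  have h1 : ∀ᵐ s ∂Γ.edgeMeasure e, ∀ a, M.extend a (u a) ⟨e, s⟩ = 0 :=
    ae_all_iff.2 fun a => M.extend_of_notMem (fun h' => h (prec_init_of_mem_branch a.2 h')) _
  filter_upwards [h1, L2.coeFn_sum_edge Finset.univ (fun a => M.extend a (u a)) e] with s h1 h2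
  rw [h2]
  exact Finset.sum_eq_zero fun a _ => h1 a

theorem exists_match {e : Γ.Edge} (h : Γ.Prec v e.init) :
    ∃ a e', e' ∈ (M.edgeMatch a).toPEquiv e := by
  obtain ⟨a, ha, hae⟩ := exists_mem_branch h
  obtain ⟨e', he'⟩ := (M.exists_mem_iff ⟨a, ha⟩ e).2 hae
  exact ⟨⟨a, ha⟩, e', he'⟩

theorem extend_restrict {a : Γ.outEdges v} {u : Γ.L2}
    (h : ∀ e ∉ Γ.branch a.1.term, ∀ᵐ s ∂Γ.edgeMeasure e, u ⟨e, s⟩ = 0) :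
    M.extend a (M.restrict a u) = u := by
  refine L2.ext_edges fun e => ?_
  by_cases he : e ∈ Γ.branch a.1.term
  · obtain ⟨e', he'⟩ := (M.exists_mem_iff a e).2 he
    have h1 := M.restrict_of_mem he' u
    rw [← M.edgeMeasure_eq he'] at h1
    filter_upwards [h1, M.extend_of_mem he' (M.restrict a u)] with s h1 h2
    rw [h2, h1]
  · filter_upwards [h e he, M.extend_of_notMem he (M.restrict a u)] with s h1 h2
    rw [h2, h1]

/-! ### The subspace `F'_v` in terms of the branches -/

theorem restrict_mem_FSymm (h' : Γ'.IsRegular b' t')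
    {a : Γ.outEdges v} {u : Γ.L2}
    (hu : ∀ e ∈ Γ.branch a.1.term, ∀ e' ∈ Γ.branch a.1.term, e.level = e'.level →
      ∀ᵐ s ∂Γ.edgeMeasure e, u ⟨e, s⟩ = u ⟨e', s⟩) : M.restrict a u ∈ Γ'.FSymm := by
  refine (h'.mem_FSymm_iff _).2 fun e1 e2 he => ?_
  obtain ⟨d1, hd1⟩ := M.exists_mem a e1
  obtain ⟨d2, hd2⟩ := M.exists_mem a e2
  have h1 := M.restrict_of_mem hd1 u
  have h2 := M.restrict_of_mem hd2 u
  have h3 := hu d1 (M.mem_branch hd1) d2 (M.mem_branch hd2)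
    (by rw [M.level_eq hd1, M.level_eq hd2, he])
  rw [M.edgeMeasure_eq hd1] at h3
  rw [edgeMeasure_congr (show Γ'.len e2 = Γ'.len e1 by rw [h'.len_eq, h'.len_eq, he])] at h2
  filter_upwards [h1, h2, h3] with s h1 h2 h3
  rw [h1, h2, h3]

theorem extend_mem_FEdge (h : Γ.IsRegular b t) (h' : Γ'.IsRegular b' t')
    (a : Γ.outEdges v) {u : Γ'.L2} (hu : u ∈ Γ'.FSymm) :
    M.extend a u ∈ Γ.FEdge a.1 := by
  refine (h.mem_FEdge_iff _ _).2 ⟨fun e he => M.extend_of_notMem he u, fun e1 he1 e2 he2 he => ?_⟩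
  obtain ⟨d1, hd1⟩ := (M.exists_mem_iff a e1).2 he1
  obtain ⟨d2, hd2⟩ := (M.exists_mem_iff a e2).2 he2
  have h1 := M.extend_of_mem hd1 u
  have h2 := M.extend_of_mem hd2 u
  have hl := M.level_eq hd1
  have hl' := M.level_eq hd2
  have h3 := (h'.mem_FSymm_iff u).1 hu d1 d2 (by omega)
  rw [← M.edgeMeasure_eq hd1] at h3
  rw [edgeMeasure_congr (show Γ.len e2 = Γ.len e1 by rw [h.len_eq, h.len_eq, he])] at h2
  filter_upwards [h1, h2, h3] with s h1 h2 h3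
  rw [h1, h2, h3]

theorem sum_extend_mem_FVertex (h : Γ.IsRegular b t) (h' : Γ'.IsRegular b' t')
    {u : Γ'.L2} (hu : u ∈ Γ'.FSymm) :
    ∑ a, M.extend a u ∈ Γ.FVertex v := by
  refine (h.mem_FVertex_iff _ _).2 ⟨fun e he => M.sum_extend_of_not_prec he _,
    fun e1 e2 he1 he2 he => ?_⟩
  obtain ⟨a1, d1, hd1⟩ := M.exists_match he1
  obtain ⟨a2, d2, hd2⟩ := M.exists_match he2
  have h1 := M.sum_extend_of_mem hd1 fun _ => u
  have h2 := M.sum_extend_of_mem hd2 fun _ => u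
  have hl := M.level_eq hd1
  have hl' := M.level_eq hd2
  have h3 := (h'.mem_FSymm_iff u).1 hu d1 d2 (by omega)
  rw [← M.edgeMeasure_eq hd1] at h3
  rw [edgeMeasure_congr (show Γ.len e2 = Γ.len e1 by rw [h.len_eq, h.len_eq, he])] at h2
  filter_upwards [h1, h2, h3] with s h1 h2 h3
  rw [h1, h2, h3]

theorem restrict_eq_of_mem_FVertex (h : Γ.IsRegular b t)
    {u : Γ.L2} (hu : u ∈ Γ.FVertex v) (a a' : Γ.outEdges v) :
    M.restrict a u = M.restrict a' u := by
  refine L2.ext_edges fun e => ?_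
  obtain ⟨d1, hd1⟩ := M.exists_mem a e
  obtain ⟨d2, hd2⟩ := M.exists_mem a' e
  have h3 := ((h.mem_FVertex_iff _ _).1 hu).2 d1 d2
    (prec_init_of_mem_branch a.2 (M.mem_branch hd1))
    (prec_init_of_mem_branch a'.2 (M.mem_branch hd2)) (by rw [M.level_eq hd1, M.level_eq hd2])
  rw [M.edgeMeasure_eq hd1] at h3
  filter_upwards [M.restrict_of_mem hd1 u, M.restrict_of_mem hd2 u, h3] with s h1 h2 h3
  rw [h1, h2, h3]

/-- The elements of `⊕ F_e` consist of one symmetric function on `Γ'` for every branch. -/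
theorem restrict_of_mem_FTilde (h : Γ.IsRegular b t) (h' : Γ'.IsRegular b' t')
    {u : Γ.L2} (hu : u ∈ Γ.FTilde v) :
    (∀ a, M.restrict a u ∈ Γ'.FSymm) ∧ ∑ a, M.extend a (M.restrict a u) = u := by
  let Q : Submodule ℂ Γ.L2 :=
    { carrier := {u | (∀ a, M.restrict a u ∈ Γ'.FSymm) ∧ ∑ a, M.extend a (M.restrict a u) = u}
      zero_mem' := by simp
      add_mem' := fun {x y} hx hy => ⟨fun a => by
          rw [map_add]; exact Submodule.add_mem _ (hx.1 a) (hy.1 a), by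
          simp only [map_add, Finset.sum_add_distrib, hx.2, hy.2]⟩
      smul_mem' := fun c x hx => ⟨fun a => by
          rw [map_smul]; exact Submodule.smul_mem _ c (hx.1 a), by
          simp only [map_smul, ← Finset.smul_sum, hx.2]⟩ }
  suffices Γ.FTilde v ≤ Q from this hu
  refine iSup₂_le fun a ha u hu => ?_
  obtain ⟨h1, h2⟩ := (h.mem_FEdge_iff _ _).1 hu
  have hu' : M.extend ⟨a, ha⟩ (M.restrict ⟨a, ha⟩ u) = u := M.extend_restrict h1
  have hne : ∀ a', a' ≠ ⟨a, ha⟩ → M.restrict a' u = 0 := fun a' hne => by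
    rw [← hu', M.restrict_extend_of_ne hne]
  refine ⟨fun a' => ?_, ?_⟩
  · by_cases hne' : a' = ⟨a, ha⟩
    · rw [hne']; exact M.restrict_mem_FSymm h' h2
    · rw [hne a' hne']; exact Submodule.zero_mem _
  · rw [Finset.sum_eq_single ⟨a, ha⟩, hu']
    · exact fun a' _ h => by rw [hne a' h, map_zero]
    · exact fun h => (h (Finset.mem_univ _)).elim

/-- The elements of `F'_v` consist of one symmetric function on `Γ'` for every branch, and these
functions sum up to zero. -/
theorem mem_FPrime_iff (h : Γ.IsRegular b t) (h' : Γ'.IsRegular b' t')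
    {u : Γ.L2} :
    u ∈ Γ.FPrime v ↔ (∀ a, M.restrict a u ∈ Γ'.FSymm) ∧ ∑ a, M.restrict a u = 0 ∧
      ∑ a, M.extend a (M.restrict a u) = u := by
  constructor
  · rintro ⟨h1, h2⟩
    obtain ⟨h3, h4⟩ := M.restrict_of_mem_FTilde h h' h1
    refine ⟨h3, ?_, h4⟩
    have h5 := Submodule.inner_right_of_mem_orthogonal
      (M.sum_extend_mem_FVertex h h'
        (Submodule.sum_mem _ (t := Finset.univ) fun a _ => h3 a)) h2
    rw [sum_inner] at h5
    simp only [M.inner_extend] at h5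
    rw [← inner_sum] at h5
    exact inner_self_eq_zero.1 h5
  · rintro ⟨h1, h2, h3⟩
    refine ⟨?_, ?_⟩
    · rw [← h3]
      exact Submodule.sum_mem _ fun a _ => Submodule.mem_iSup_of_mem a.1
        (Submodule.mem_iSup_of_mem a.2 (M.extend_mem_FEdge h h' a (h1 a)))
    · refine (Submodule.mem_orthogonal _ _).2 fun w hw => ?_
      rw [← inner_conj_symm, ← h3, sum_inner]
      simp only [M.inner_extend]
      rcases isEmpty_or_nonempty (Γ.outEdges v) with hE | ⟨⟨a0⟩⟩
      · simp
      · simp only [M.restrict_eq_of_mem_FVertex h hw _ a0]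
        rw [← sum_inner, h2, inner_zero_left, map_zero]

end BranchMatch

end MetricTree

/-! ### Weak derivatives and continuous representatives of symmetric functions -/

namespace MetricTree

open RootedGraphTree

variable {V V' : Type*} {Γ : MetricTree V} {Γ' : MetricTree V'} {b b' : ℕ → ℕ} {t t' : ℕ → ℝ}

/-- The partial bijection between two single edges of the same length. -/
def EdgeMatch.single (e : Γ.Edge) (e' : Γ'.Edge) (h : Γ.len e = Γ'.len e') : EdgeMatch Γ Γ' where
  toPEquiv := by classical exact PEquiv.single e e'
  len_eq h1 := by
    classical
    rw [PEquiv.mem_single_iff] at h1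
    rw [h1.1, h1.2, h]

theorem EdgeMatch.mem_single (e : Γ.Edge) (e' : Γ'.Edge) (h : Γ.len e = Γ'.len e') :
    e' ∈ (EdgeMatch.single e e' h).toPEquiv e := by
  classical
  exact (PEquiv.mem_single_iff _ _ _ _).2 ⟨rfl, rfl⟩

theorem EdgeMatch.single_eq_none {e d : Γ.Edge} {e' : Γ'.Edge} {h : Γ.len e = Γ'.len e'}
    (hd : d ≠ e) : (EdgeMatch.single e e' h).toPEquiv d = none := by
  classical
  exact PEquiv.single_apply_of_ne hd.symm _

/-- If a function agrees on two edges then so does its weak derivative: moving both edges to the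
same place gives the same function, and weak derivatives are unique. -/
theorem IsWeakDeriv.congr_edge {u u' : Γ.L2} (h : Γ.IsWeakDeriv u u') {e e' : Γ.Edge}
    (hl : Γ.len e = Γ.len e') (hu : ∀ᵐ s ∂Γ.edgeMeasure e, u ⟨e, s⟩ = u ⟨e', s⟩) :
    ∀ᵐ s ∂Γ.edgeMeasure e, u' ⟨e, s⟩ = u' ⟨e', s⟩ := by
  have heq : (EdgeMatch.single e e rfl).transfer u = (EdgeMatch.single e e' hl).transfer u := by
    refine L2.ext_edges fun d => ?_
    by_cases hd : d = e
    · subst hd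
      filter_upwards [hu, (EdgeMatch.single d d rfl).transfer_of_mem u (EdgeMatch.mem_single _ _ _),
        (EdgeMatch.single d e' hl).transfer_of_mem u (EdgeMatch.mem_single _ _ _)] with s h1 h2 h3
      rw [h2, h3, h1]
    · filter_upwards [
        (EdgeMatch.single e e rfl).transfer_of_eq_none u (EdgeMatch.single_eq_none hd),
        (EdgeMatch.single e e' hl).transfer_of_eq_none u (EdgeMatch.single_eq_none hd)] with s h1 h2
      rw [h1, h2]
  have h1 := (EdgeMatch.single e e rfl).isWeakDeriv_transfer h
  rw [heq] at h1
  have h2 := h1.unique ((EdgeMatch.single e e' hl).isWeakDeriv_transfer h)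
  have h3 := (EdgeMatch.single e e rfl).transfer_of_mem u' (EdgeMatch.mem_single _ _ _)
  rw [h2] at h3
  filter_upwards [h3, (EdgeMatch.single e e' hl).transfer_of_mem u' (EdgeMatch.mem_single _ _ _)]
    with s h3 h4
  rw [← h3, h4]

theorem IsRegular.len_congr (h : Γ.IsRegular b t) {e e' : Γ.Edge} (he : e.level = e'.level) :
    Γ.len e = Γ.len e' := by rw [h.len_eq, h.len_eq, he]

theorem IsRegular.isWeakDeriv_mem_FSymm (h : Γ.IsRegular b t) {u u' : Γ.L2}
    (hd : Γ.IsWeakDeriv u u') (hu : u ∈ Γ.FSymm) : u' ∈ Γ.FSymm :=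
  (h.mem_FSymm_iff u').2 fun e e' he =>
    hd.congr_edge (h.len_congr he) ((h.mem_FSymm_iff u).1 hu e e' he)

namespace IsContRep

/-- Continuous representatives of functions which agree almost everywhere agree up to the
endpoints of the edges. -/
theorem eqOn {u : Γ.L2} {F : Γ.Edge → ℝ → ℂ} (h : Γ.IsContRep u F) {w : Γ'.L2}
    {G : Γ'.Edge → ℝ → ℂ} (h' : Γ'.IsContRep w G) {e : Γ.Edge} {e' : Γ'.Edge}
    (hl : Γ.len e = Γ'.len e') (huw : ∀ᵐ s ∂Γ.edgeMeasure e, u ⟨e, s⟩ = w ⟨e', s⟩) :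
    Set.EqOn (F e) (G e') (Set.Icc 0 (Γ.len e)) := by
  have hG := h' e'
  rw [← edgeMeasure_congr hl, ← hl] at hG
  refine Measure.eqOn_Icc_of_ae_eq volume (Γ.len_pos e).ne ?_ (h e).1 hG.1
  rw [← Measure.restrict_congr_set Ioo_ae_eq_Icc]
  filter_upwards [(h e).2, hG.2, huw] with s h1 h2 h3
  rw [← h1, ← h2, h3]

theorem zero : Γ.IsContRep 0 fun _ _ => 0 := fun e =>
  ⟨continuousOn_const, L2.coeFn_zero_edge e⟩

theorem sum {ι : Type*} {s : Finset ι} {u : ι → Γ.L2} {F : ι → Γ.Edge → ℝ → ℂ}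
    (h : ∀ i ∈ s, Γ.IsContRep (u i) (F i)) :
    Γ.IsContRep (∑ i ∈ s, u i) fun e x => ∑ i ∈ s, F i e x := by
  intro e
  refine ⟨continuousOn_finsetSum _ fun i hi => (h i hi e).1, ?_⟩
  have h1 : ∀ᵐ x ∂Γ.edgeMeasure e, ∀ i ∈ s, u i ⟨e, x⟩ = F i e x :=
    (ae_ball_iff s.countable_toSet).2 fun i hi => (h i hi e).2
  filter_upwards [L2.coeFn_sum_edge s u e, h1] with x h2 h3
  rw [h2]
  exact Finset.sum_congr rfl h3

theorem transfer (p : EdgeMatch Γ Γ') {u : Γ'.L2} {F : Γ'.Edge → ℝ → ℂ}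
    (h : Γ'.IsContRep u F) : Γ.IsContRep (p.transfer u) (p.pullFun F) := by
  intro e
  rcases he : p.toPEquiv e with _ | e'
  · have h0 : p.pullFun F e = fun _ => 0 := funext (p.pullFun_of_eq_none he)
    rw [h0]
    exact ⟨continuousOn_const, p.transfer_of_eq_none u he⟩
  · have h0 : p.pullFun F e = F e' := funext (p.pullFun_of_mem he)
    have hl := p.len_eq he
    have h1 := h e'
    rw [← hl, ← edgeMeasure_congr hl] at h1
    rw [h0]
    refine ⟨h1.1, ?_⟩
    filter_upwards [h1.2, p.transfer_of_mem u he] with s h1 h2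
    rw [h2, h1]

end IsContRep

/-! ### The matching conditions for symmetric functions -/

/-- The matching conditions for functions whose values depend on the level only: a condition on the
boundary values for every pair of consecutive levels. -/
structure LevelMatching (Γ : MetricTree V) (F₁ F₂ : Γ.Edge → ℝ → ℂ) : Prop where
  root : ∀ e : Γ.Edge, e.level = 0 → F₁ e 0 = 0
  cont : ∀ e e' : Γ.Edge, e'.level = e.level + 1 → F₁ e' 0 = F₁ e (Γ.len e)
  kirchhoff : ∀ e e' : Γ.Edge, e'.level = e.level + 1 →
    F₂ e (Γ.len e) = Γ.branching e.term * F₂ e' 0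

theorem finsum_outEdges_const (v : V) {f : Γ.Edge → ℂ} {c : ℂ} (h : ∀ e ∈ Γ.outEdges v, f e = c) :
    ∑ᶠ e ∈ Γ.outEdges v, f e = Γ.branching v * c := by
  rw [finsum_mem_congr rfl h, finsum_mem_eq_finite_toFinset_sum _ (Γ.outEdges_finite v),
    Finset.sum_const, nsmul_eq_mul, branching, Set.ncard_eq_toFinset_card _ (Γ.outEdges_finite v)]

theorem zero_mem_Icc_len (e : Γ.Edge) : (0 : ℝ) ∈ Set.Icc 0 (Γ.len e) :=
  Set.left_mem_Icc.2 (Γ.len_pos e).le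

theorem len_mem_Icc_len (e : Γ.Edge) : Γ.len e ∈ Set.Icc 0 (Γ.len e) :=
  Set.right_mem_Icc.2 (Γ.len_pos e).le

theorem IsRegular.eq_at_zero (h : Γ.IsRegular b t) {u : Γ.L2} (hu : u ∈ Γ.FSymm)
    {F : Γ.Edge → ℝ → ℂ} (hF : Γ.IsContRep u F) {e e' : Γ.Edge} (he : e.level = e'.level) :
    F e 0 = F e' 0 :=
  hF.eqOn hF (h.len_congr he) ((h.mem_FSymm_iff u).1 hu e e' he) (zero_mem_Icc_len e)

theorem IsRegular.levelMatching (h : Γ.IsRegular b t) {u : Fin 2 → Γ.L2} (hu : ∀ i, u i ∈ Γ.FSymm)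
    {F : Fin 2 → Γ.Edge → ℝ → ℂ} (hF : ∀ i, Γ.IsContRep (u i) (F i))
    (hm : Γ.Matching (F 0) (F 1)) : Γ.LevelMatching (F 0) (F 1) where
  root e he := hm.root e (eq_root_of_gen_eq_zero he)
  cont e e' he := by
    obtain ⟨d, hd⟩ := h.exists_outEdge e.term
    rw [← hm.cont e d hd]
    exact h.eq_at_zero (hu 0) (hF 0) (by rw [he, level_of_mem_outEdges hd])
  kirchhoff e e' he := by
    rw [hm.kirchhoff]
    refine finsum_outEdges_const _ fun d hd => ?_
    exact h.eq_at_zero (hu 1) (hF 1) (by rw [he, level_of_mem_outEdges hd])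

theorem LevelMatching.matching {F₁ F₂ : Γ.Edge → ℝ → ℂ} (hm : Γ.LevelMatching F₁ F₂)
    (h : Γ.IsRegular b t) : Γ.Matching F₁ F₂ where
  root e he := hm.root e (by rw [Edge.level, show e.init = Γ.root from he, gen_root])
  cont e e' he' := hm.cont e e' (level_of_mem_outEdges he')
  kirchhoff e := by
    obtain ⟨d, hd⟩ := h.exists_outEdge e.term
    have hl := hm.kirchhoff e d (level_of_mem_outEdges hd)
    rw [hl]
    refine (finsum_outEdges_const _ fun d' hd' => ?_).symm
    refine mul_left_cancel₀ (Nat.cast_ne_zero.2 (h.branching_pos e.term).ne') ?_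
    rw [← hm.kirchhoff e d' (level_of_mem_outEdges hd'), hl]

/-! ### Spinors and the Dirac operator -/

/-- A linear map between `L²` spaces, applied to both components of a spinor. -/
def Spinor.map (T : Γ.L2 →ₗ[ℂ] Γ'.L2) : Γ.Spinor →ₗ[ℂ] Γ'.Spinor where
  toFun f := Spinor.mk fun i => T (f.comp i)
  map_add' f g := Spinor.ext fun i => by
    simp only [Spinor.comp_mk, Spinor.comp_add, map_add]
  map_smul' a f := Spinor.ext fun i => by
    simp only [Spinor.comp_mk, Spinor.comp_smul, map_smul, RingHom.id_apply]

theorem Spinor.comp_map (T : Γ.L2 →ₗ[ℂ] Γ'.L2) (f : Γ.Spinor) (i : Fin 2) :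
    (Spinor.map T f).comp i = T (f.comp i) := rfl

theorem Spinor.comp_sum {ι : Type*} (s : Finset ι) (f : ι → Γ.Spinor) (i : Fin 2) :
    (∑ j ∈ s, f j).comp i = ∑ j ∈ s, (f j).comp i := by
  classical
  induction s using Finset.induction_on with
  | empty => rfl
  | insert j s hj ih => rw [Finset.sum_insert hj, Finset.sum_insert hj, Spinor.comp_add, ih]

theorem diracExpr_map (T : Γ.L2 →ₗ[ℂ] Γ'.L2) (c : ℝ) (f f' : Γ.Spinor) :
    Γ'.diracExpr c (Spinor.map T f) (Spinor.map T f') = Spinor.map T (Γ.diracExpr c f f') := by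
  refine Spinor.ext fun i => ?_
  simp only [diracExpr, Spinor.comp_map, Spinor.comp_mk, map_sum, map_add, map_smul]

theorem diracExpr_sum {ι : Type*} (s : Finset ι) (c : ℝ) (f f' : ι → Γ.Spinor) :
    Γ.diracExpr c (∑ j ∈ s, f j) (∑ j ∈ s, f' j) = ∑ j ∈ s, Γ.diracExpr c (f j) (f' j) := by
  refine Spinor.ext fun i => ?_
  simp only [diracExpr, Spinor.comp_sum, Spinor.comp_mk, Finset.smul_sum,
    ← Finset.sum_add_distrib]
  exact Finset.sum_comm

theorem diracExpr_mem {F : Submodule ℂ Γ.L2} {f f' : Γ.Spinor} (hf : f ∈ tensorC2 F)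
    (hf' : f' ∈ tensorC2 F) (c : ℝ) : Γ.diracExpr c f f' ∈ tensorC2 F := fun i => by
  rw [diracExpr, Spinor.comp_mk]
  exact F.sum_mem fun j _ => F.add_mem (F.smul_mem _ (hf' j)) (F.smul_mem _ (hf j))

theorem mem_diracGraph_iff {c : ℝ} {f g : Γ.Spinor} :
    (f, g) ∈ Γ.diracGraph c ↔ ∃ f', Γ.IsDiracPair f f' ∧ g = Γ.diracExpr c f f' := Iff.rfl

/-- A subspace which is closed under weak derivatives reduces to a subspace invariant under the
Dirac operator. -/
theorem leavesInvariant_of_isWeakDeriv {F : Submodule ℂ Γ.L2}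
    (hF : ∀ u u', Γ.IsWeakDeriv u u' → u ∈ F → u' ∈ F) (c : ℝ) :
    (Γ.dirac c).LeavesInvariant (tensorC2 F) := by
  intro x hx
  have hg : ((x : Γ.Spinor), Γ.dirac c x) ∈ (Γ.dirac c).graph := LinearPMap.mem_graph _ x
  rw [dirac_graph, mem_diracGraph_iff] at hg
  obtain ⟨f', h1, h2⟩ := hg
  rw [h2]
  exact diracExpr_mem hx (fun i => hF _ _ (h1.1 i) (hx i)) c

theorem IsRegular.leavesInvariant_FSymm (h : Γ.IsRegular b t) (c : ℝ) :
    (Γ.dirac c).LeavesInvariant (tensorC2 Γ.FSymm) :=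
  leavesInvariant_of_isWeakDeriv (fun _ _ hd hu => h.isWeakDeriv_mem_FSymm hd hu) c

namespace BranchMatch

variable {v : V} (M : BranchMatch Γ Γ' v)

theorem isWeakDeriv_mem_FPrime (M : BranchMatch Γ Γ' v) (h : Γ.IsRegular b t)
    (h' : Γ'.IsRegular b' t') {u u' : Γ.L2} (hd : Γ.IsWeakDeriv u u') (hu : u ∈ Γ.FPrime v) :
    u' ∈ Γ.FPrime v := by
  obtain ⟨h1, h2, h3⟩ := (M.mem_FPrime_iff h h').1 hu
  have hR : ∀ a, Γ'.IsWeakDeriv (M.restrict a u) (M.restrict a u') := fun a =>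
    (M.edgeMatch a).symm.isWeakDeriv_transfer hd
  refine (M.mem_FPrime_iff h h').2 ⟨fun a => h'.isWeakDeriv_mem_FSymm (hR a) (h1 a), ?_, ?_⟩
  · have h4 := IsWeakDeriv.sum (s := Finset.univ) fun a _ => hR a
    rw [h2] at h4
    exact h4.eq_zero
  · have h4 := IsWeakDeriv.sum (s := Finset.univ) fun a _ =>
      (M.edgeMatch a).isWeakDeriv_transfer (hR a)
    refine IsWeakDeriv.unique h4 ?_
    rw [show ∑ a, (M.edgeMatch a).transfer (M.restrict a u) = u from h3]
    exact hd

theorem leavesInvariant_FPrime (M : BranchMatch Γ Γ' v) (h : Γ.IsRegular b t)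
    (h' : Γ'.IsRegular b' t') (c : ℝ) :
    (Γ.dirac c).LeavesInvariant (tensorC2 (Γ.FPrime v)) :=
  leavesInvariant_of_isWeakDeriv (fun _ _ hd hu => M.isWeakDeriv_mem_FPrime h h' hd hu) c

/-- The branching numbers agree along the identification of the branches. -/
theorem branching_eq (h : Γ.IsRegular b t) (h' : Γ'.IsRegular b' t')
    (hb : ∀ n, 0 < n → b (Γ.gen v + n) = b' n) {a : Γ.outEdges v} {e : Γ.Edge} {e' : Γ'.Edge}
    (he : e' ∈ (M.edgeMatch a).toPEquiv e) : Γ.branching e.term = Γ'.branching e'.term := by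
  rw [h.branching_eq, h'.branching_eq, e.gen_term, e'.gen_term, M.level_eq he, ← hb _ (by omega),
    add_assoc]

/-- The restriction of a function in the domain of the Dirac operator to a branch is in the domain
of the Dirac operator on the smaller tree: it vanishes on the edge which terminates at `v`, and by
continuity its first component vanishes at `v`. -/
theorem isDiracPair_restrict (h : Γ.IsRegular b t) (h' : Γ'.IsRegular b' t')
    (hb : ∀ n, 0 < n → b (Γ.gen v + n) = b' n) (hv : 0 < Γ.gen v) {f f' : Γ.Spinor}
    (hf : f ∈ tensorC2 (Γ.FPrime v)) (hd : Γ.IsDiracPair f f') (a : Γ.outEdges v) :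
    Γ'.IsDiracPair (Spinor.map (M.restrict a) f) (Spinor.map (M.restrict a) f') := by
  obtain ⟨h1, F, h2, hm⟩ := hd
  have hF := fun i => (M.mem_FPrime_iff h h').1 (hf i)
  refine ⟨fun i => (M.edgeMatch a).symm.isWeakDeriv_transfer (h1 i),
    fun i => (M.edgeMatch a).symm.pullFun (F i), fun i => (h2 i).transfer _, ?_⟩
  have hrep : ∀ i, Γ'.IsContRep (M.restrict a (f.comp i)) ((M.edgeMatch a).symm.pullFun (F i)) :=
    fun i => (h2 i).transfer _
  have hval : ∀ {e : Γ.Edge} {e' : Γ'.Edge}, e' ∈ (M.edgeMatch a).toPEquiv e → ∀ i s,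
      (M.edgeMatch a).symm.pullFun (F i) e' s = F i e s := fun he i s =>
    (M.edgeMatch a).symm.pullFun_of_mem ((M.edgeMatch a).mem_symm.2 he) s
  -- the values at the start of the edges which continue an edge of the branch
  have hnext : ∀ {e d : Γ.Edge} {e' d' : Γ'.Edge}, e' ∈ (M.edgeMatch a).toPEquiv e →
      d' ∈ (M.edgeMatch a).toPEquiv d → d'.level = e'.level + 1 →
      ∀ e1 ∈ Γ.outEdges e.term, ∀ i, F i e1 0 = F i d 0 := by
    intro e d e' d' he hd hl e1 he1 i
    obtain ⟨e1', he1'⟩ :=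
      (M.exists_mem_iff a e1).2 (mem_branch_of_mem_outEdges (M.mem_branch he) he1)
    have hl1 := M.level_eq he1'
    have hl2 := M.level_eq he
    have hl3 := level_of_mem_outEdges he1
    rw [← hval he1', ← hval hd]
    exact h'.eq_at_zero ((hF i).1 a) (hrep i) (by omega)
  suffices Γ'.LevelMatching ((M.edgeMatch a).symm.pullFun (F 0))
      ((M.edgeMatch a).symm.pullFun (F 1)) from this.matching h'
  refine ⟨fun e' he' => ?_, fun e' d' hl => ?_, fun e' d' hl => ?_⟩
  · obtain ⟨e, he⟩ := M.exists_mem a e'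
    have hea : e = a.1 := by
      refine eq_of_mem_branch_of_level_eq (M.mem_branch he) ?_
      rw [M.level_eq he, he', add_zero, Edge.level, show a.1.init = v from a.2]
    have hvr : v ≠ Γ.root := by
      rintro rfl
      rw [gen_root] at hv
      exact hv.false
    obtain ⟨d, hdv⟩ := exists_edge_term hvr
    have hd0 : ∀ᵐ s ∂Γ.edgeMeasure d, f.comp 0 ⟨d, s⟩ = (0 : Γ.L2) ⟨d, s⟩ := by
      have := M.sum_extend_of_not_prec (e := d) (by rw [← hdv]; exact not_prec_term_init d)
        fun a => M.restrict a (f.comp 0)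
      rw [(hF 0).2.2] at this
      filter_upwards [this, L2.coeFn_zero_edge d] with s h1 h2
      rw [h1, h2]
    rw [hval he, hea, hm.cont d a.1 (by rw [hdv]; exact a.2)]
    exact (h2 0).eqOn IsContRep.zero rfl hd0 (len_mem_Icc_len d)
  · obtain ⟨e, he⟩ := M.exists_mem a e'
    obtain ⟨d, hd⟩ := M.exists_mem a d'
    obtain ⟨e1, he1⟩ := h.exists_outEdge e.term
    rw [hval hd, hval he, ← hnext he hd hl e1 he1, hm.cont e e1 he1, (M.edgeMatch a).len_eq he]
  · obtain ⟨e, he⟩ := M.exists_mem a e'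
    obtain ⟨d, hd⟩ := M.exists_mem a d'
    rw [hval hd, hval he, ← (M.edgeMatch a).len_eq he, hm.kirchhoff,
      ← M.branching_eq h h' hb he]
    exact finsum_outEdges_const _ fun e1 he1 => hnext he hd hl e1 he1 1

/-- Functions in the domain of the Dirac operator on the smaller tree, one for each branch, which
sum up to zero can be glued to a function in the domain on the large tree: the first component
vanishes at `v`, and the vanishing sum is the condition at `v` for the second one. -/
theorem isDiracPair_of_restrict (h : Γ.IsRegular b t) (h' : Γ'.IsRegular b' t')
    (hb : ∀ n, 0 < n → b (Γ.gen v + n) = b' n) (hv : 0 < Γ.gen v) {f : Γ.Spinor}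
    (hf : f ∈ tensorC2 (Γ.FPrime v)) {f' : Γ.outEdges v → Γ'.Spinor}
    (hd : ∀ a, Γ'.IsDiracPair (Spinor.map (M.restrict a) f) (f' a)) :
    Γ.IsDiracPair f (∑ a, Spinor.map (M.extend a) (f' a)) := by
  have hF := fun i => (M.mem_FPrime_iff h h').1 (hf i)
  choose h1 G h2 hm using hd
  have hlm : ∀ a, Γ'.LevelMatching (G a 0) (G a 1) := fun a =>
    h'.levelMatching (u := fun i => M.restrict a (f.comp i)) (fun i => (hF i).1 a) (h2 a) (hm a)
  -- the glued continuous representatives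
  let H : Fin 2 → Γ.Edge → ℝ → ℂ := fun i e s => ∑ a, (M.edgeMatch a).pullFun (G a i) e s
  have hval : ∀ {a : Γ.outEdges v} {e : Γ.Edge} {e' : Γ'.Edge}, e' ∈ (M.edgeMatch a).toPEquiv e →
      ∀ i s, H i e s = G a i e' s := by
    intro a e e' he i s
    refine (Finset.sum_eq_single a (fun a' _ ha' => ?_)
      fun h => (h (Finset.mem_univ a)).elim).trans ((M.edgeMatch a).pullFun_of_mem he s)
    refine (M.edgeMatch a').pullFun_of_eq_none (M.eq_none fun h => ha' ?_) s
    exact Subtype.ext (branch_disjoint a'.2 a.2 h (M.mem_branch he))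
  have hzero : ∀ {e : Γ.Edge}, ¬ Γ.Prec v e.init → ∀ i s, H i e s = 0 := by
    intro e he i s
    refine Finset.sum_eq_zero fun a _ =>
      (M.edgeMatch a).pullFun_of_eq_none (M.eq_none fun h => ?_) s
    exact he <| prec_init_of_mem_branch a.2 h
  have hroot : ∀ a : Γ.outEdges v, ∃ e', e' ∈ (M.edgeMatch a).toPEquiv a.1 ∧ e'.level = 0 := by
    intro a
    obtain ⟨e', he'⟩ := (M.exists_mem_iff a a.1).2 (prec_refl _)
    have hl := M.level_eq he'
    rw [Edge.level, show a.1.init = v from a.2] at hl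
    exact ⟨e', he', by omega⟩
  have hsum : ∀ i e', ∑ a, G a i e' 0 = 0 := by
    intro i e'
    have h3 := IsContRep.sum (s := Finset.univ) fun a _ => h2 a i
    have h4 : ∑ a, (Spinor.map (M.restrict a) f).comp i = 0 := (hF i).2.1
    rw [h4] at h3
    exact h3.eqOn IsContRep.zero rfl (Filter.Eventually.of_forall fun _ => rfl)
      (zero_mem_Icc_len e')
  refine ⟨fun i => ?_, H, fun i => ?_, ?_⟩
  · have h3 := IsWeakDeriv.sum (s := Finset.univ) fun a _ =>
      (M.edgeMatch a).isWeakDeriv_transfer (h1 a i)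
    have h4 : ∑ a, (M.edgeMatch a).transfer ((Spinor.map (M.restrict a) f).comp i) = f.comp i :=
      (hF i).2.2
    rw [h4] at h3
    rw [Spinor.comp_sum]
    exact h3
  · have h3 := IsContRep.sum (s := Finset.univ) fun a _ => (h2 a i).transfer (M.edgeMatch a)
    have h4 : ∑ a, (M.edgeMatch a).transfer ((Spinor.map (M.restrict a) f).comp i) = f.comp i :=
      (hF i).2.2
    rw [h4] at h3
    exact h3
  -- an edge which continues an edge of the branch of `a` is in the same branch
  have hnext : ∀ {a : Γ.outEdges v} {e : Γ.Edge} {e' : Γ'.Edge},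
      e' ∈ (M.edgeMatch a).toPEquiv e → ∀ d ∈ Γ.outEdges e.term,
      ∃ d', d' ∈ (M.edgeMatch a).toPEquiv d ∧ d'.level = e'.level + 1 := by
    intro a e e' he d hd
    obtain ⟨d', hd'⟩ :=
      (M.exists_mem_iff a d).2 (mem_branch_of_mem_outEdges (M.mem_branch he) hd)
    have hl1 := M.level_eq hd'
    have hl2 := M.level_eq he
    have hl3 := level_of_mem_outEdges hd
    exact ⟨d', hd', by omega⟩
  -- an edge which continues an edge outside the branches starts at `v` or lies outside as well
  have hout : ∀ {e d : Γ.Edge}, ¬ Γ.Prec v e.init → v ≠ e.term → d ∈ Γ.outEdges e.term →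
      ¬ Γ.Prec v d.init := by
    intro e d he hne hd hp
    rw [show d.init = e.term from hd, e.prec_term_iff] at hp
    exact hp.elim hne he
  refine ⟨fun e he => hzero (fun hp => ?_) 0 0, fun e d hd => ?_, fun e => ?_⟩
  · rw [show e.init = Γ.root from he, prec_root_iff] at hp
    rw [hp, gen_root] at hv
    exact hv.false
  · by_cases hp : Γ.Prec v e.init
    · obtain ⟨a, e', he'⟩ := M.exists_match hp
      obtain ⟨d', hd', hl⟩ := hnext he' d hd
      rw [hval hd', hval he', (hlm a).cont e' d' hl, (M.edgeMatch a).len_eq he']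
    · rw [hzero hp]
      by_cases hev : v = e.term
      · obtain ⟨e', he', hl⟩ := hroot ⟨d, by rw [hev]; exact hd⟩
        rw [hval he', (hlm _).root e' hl]
      · exact hzero (hout hp hev hd) 0 0
  · by_cases hp : Γ.Prec v e.init
    · obtain ⟨a, e', he'⟩ := M.exists_match hp
      obtain ⟨d0, hd0⟩ := h.exists_outEdge e.term
      obtain ⟨d0', hd0', hl0⟩ := hnext he' d0 hd0
      rw [hval he', (M.edgeMatch a).len_eq he', (hlm a).kirchhoff e' d0' hl0,
        ← M.branching_eq h h' hb he']
      refine (finsum_outEdges_const _ fun d hd => ?_).symm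
      obtain ⟨d', hd', hl⟩ := hnext he' d hd
      rw [hval hd']
      exact h'.eq_at_zero ((hF 1).1 a) (h2 a 1) (by rw [hl, hl0])
    · rw [hzero hp]
      by_cases hev : v = e.term
      · rw [← hev, ← finsum_set_coe_eq_finsum_mem, finsum_eq_sum_of_fintype]
        rcases isEmpty_or_nonempty (Γ.outEdges v) with hE | ⟨⟨a0⟩⟩
        · simp
        obtain ⟨e0, -, he0⟩ := hroot a0
        rw [← hsum 1 e0]
        refine Finset.sum_congr rfl fun a _ => ?_
        obtain ⟨e', he', hl⟩ := hroot a
        rw [hval he', h'.level_zero_unique hl he0]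
      · refine ((finsum_outEdges_const e.term fun d hd => ?_).trans (mul_zero _)).symm
        exact hzero (hout hp hev hd) 1 0

/-- On the subspace `F'_v` the Dirac operator acts branch by branch. -/
theorem mem_diracGraph_iff_restrict (h : Γ.IsRegular b t) (h' : Γ'.IsRegular b' t')
    (hb : ∀ n, 0 < n → b (Γ.gen v + n) = b' n) (hv : 0 < Γ.gen v) (c : ℝ) {f g : Γ.Spinor}
    (hf : f ∈ tensorC2 (Γ.FPrime v)) (hg : g ∈ tensorC2 (Γ.FPrime v)) :
    (f, g) ∈ Γ.diracGraph c ↔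
      ∀ a, (Spinor.map (M.restrict a) f, Spinor.map (M.restrict a) g) ∈ Γ'.diracGraph c := by
  constructor
  · rintro ⟨f', h1, h2⟩ a
    refine ⟨_, M.isDiracPair_restrict h h' hb hv hf h1 a, ?_⟩
    simp only at h2 ⊢
    rw [h2, diracExpr_map]
  · intro hR
    choose f' h1 h2 using hR
    refine ⟨_, M.isDiracPair_of_restrict h h' hb hv hf h1, ?_⟩
    have hglue : ∀ {f : Γ.Spinor}, f ∈ tensorC2 (Γ.FPrime v) →
        ∑ a, Spinor.map (M.extend a) (Spinor.map (M.restrict a) f) = f := fun hf =>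
      Spinor.ext fun i => by
        rw [Spinor.comp_sum]
        exact ((M.mem_FPrime_iff h h').1 (hf i)).2.2
    simp only at h2 ⊢
    conv_rhs => rw [← hglue hf]
    rw [diracExpr_sum, ← hglue hg]
    refine Finset.sum_congr rfl fun a _ => ?_
    rw [diracExpr_map, h2]

end BranchMatch

end MetricTree

/-! ### Orthonormal bases of the vectors with vanishing sum -/

/-- An orthonormal basis, with `r` elements, of the space of those vectors in `ℂ^A` whose
coordinates sum up to zero. Completeness is expressed by the entries of the orthogonal projection
onto this space. -/
structure BalancedBasis (A : Type*) [Fintype A] [DecidableEq A] (r : ℕ) where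
  /-- the coordinates of the basis vectors -/
  coef : Fin r → A → ℂ
  orthonormal : ∀ i j, ∑ a, starRingEnd ℂ (coef i a) * coef j a = if i = j then 1 else 0
  sum_eq_zero : ∀ j, ∑ a, coef j a = 0
  complete : ∀ a a', ∑ j, coef j a * starRingEnd ℂ (coef j a') =
    (if a = a' then 1 else 0) - (Fintype.card A : ℂ)⁻¹

theorem BalancedBasis.nonempty (A : Type*) [Fintype A] [DecidableEq A] {r : ℕ}
    (hr : Fintype.card A = r + 1) : Nonempty (BalancedBasis A r) := by
  have : Fact (Module.finrank ℂ (EuclideanSpace ℂ A) = r + 1) :=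
    ⟨by rw [finrank_euclideanSpace, hr]⟩
  have hA : Nonempty A := Fintype.card_pos_iff.1 (by omega)
  have hc : (Fintype.card A : ℂ) ≠ 0 := Nat.cast_ne_zero.2 (by omega)
  let one : EuclideanSpace ℂ A := WithLp.toLp 2 fun _ => 1
  have hone : one ≠ 0 := fun h => by
    have := congrArg (fun x : EuclideanSpace ℂ A => x hA.some) h
    simp [one] at this
  have hmem : ∀ x : EuclideanSpace ℂ A, x ∈ (Submodule.span ℂ {one})ᗮ ↔ ∑ a, x a = 0 := by
    intro x
    rw [Submodule.mem_orthogonal_singleton_iff_inner_right, PiLp.inner_apply]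
    simp [one]
  let B := OrthonormalBasis.fromOrthogonalSpanSingleton (𝕜 := ℂ) r hone
  have hB : ∀ j, ∑ a, (B j : EuclideanSpace ℂ A) a = 0 := fun j => (hmem _).1 (B j).2
  refine ⟨⟨fun j a => (B j : EuclideanSpace ℂ A) a, fun i j => ?_, hB, fun a a' => ?_⟩⟩
  · rw [← orthonormal_iff_ite.1 B.orthonormal i j, Submodule.coe_inner, PiLp.inner_apply]
    exact Finset.sum_congr rfl fun a _ => by rw [RCLike.inner_apply, mul_comm]
  · -- expand the projection of a standard basis vector
    let x : EuclideanSpace ℂ A :=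
      WithLp.toLp 2 fun a => (if a = a' then 1 else 0) - (Fintype.card A : ℂ)⁻¹
    have hx : x ∈ (Submodule.span ℂ {one})ᗮ := by
      rw [hmem]
      simp [x, hc]
    have h1 := congrArg (fun y : (Submodule.span ℂ {one})ᗮ => (y : EuclideanSpace ℂ A) a)
      (B.sum_repr' ⟨x, hx⟩)
    have h2 : ∀ j, inner ℂ (B j) ⟨x, hx⟩ = starRingEnd ℂ ((B j : EuclideanSpace ℂ A) a') := by
      intro j
      rw [Submodule.coe_inner, PiLp.inner_apply]
      simp only [x, RCLike.inner_apply, sub_mul, Finset.sum_sub_distrib, ite_mul, one_mul, zero_mul]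
      rw [← Finset.mul_sum, ← map_sum, hB, map_zero, mul_zero, sub_zero]
      simp
    simp only [h2] at h1
    have h3 : x a = (if a = a' then 1 else 0) - (Fintype.card A : ℂ)⁻¹ := rfl
    rw [← h3, ← h1]
    simp [mul_comm]

namespace BalancedBasis

variable {A : Type*} [Fintype A] [DecidableEq A] {r : ℕ} (ξ : BalancedBasis A r)
  {H : Type*} [AddCommGroup H] [Module ℂ H]

theorem sum_coef_smul_sum (x : A → H) (hx : ∑ a, x a = 0) (a : A) :
    ∑ j, ξ.coef j a • ∑ a', starRingEnd ℂ (ξ.coef j a') • x a' = x a := by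
  simp only [Finset.smul_sum, smul_smul]
  rw [Finset.sum_comm]
  simp only [← Finset.sum_smul, ξ.complete, sub_smul, Finset.sum_sub_distrib]
  rw [← Finset.smul_sum, hx, smul_zero, sub_zero]
  simp

theorem sum_conj_smul_sum (y : Fin r → H) (i : Fin r) :
    ∑ a, starRingEnd ℂ (ξ.coef i a) • ∑ j, ξ.coef j a • y j = y i := by
  simp only [Finset.smul_sum, smul_smul]
  rw [Finset.sum_comm]
  simp only [← Finset.sum_smul, ξ.orthonormal]
  simp

theorem sum_sum_coef_smul (y : Fin r → H) : ∑ a, ∑ j, ξ.coef j a • y j = 0 := by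
  rw [Finset.sum_comm]
  simp only [← Finset.sum_smul, ξ.sum_eq_zero, zero_smul, Finset.sum_const_zero]

end BalancedBasis

/-- Let the operators `S a` be isometric with pairwise orthogonal ranges and with the adjoints
`R a`, and let `P` consist of the sums `∑ S a (x a)`, where the `x a ∈ P'` sum up to zero. Then `P`
is the orthogonal sum of `r` copies of `P'`, by means of the coordinates of `(x a)` with respect to
an orthonormal basis of the vectors with vanishing sum. -/
theorem BalancedBasis.exists_unitary {A : Type*} [Fintype A] [DecidableEq A] {r : ℕ}
    (ξ : BalancedBasis A r) {H H' : Type*} [NormedAddCommGroup H] [InnerProductSpace ℂ H]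
    [NormedAddCommGroup H'] [InnerProductSpace ℂ H'] (S : A → H' →ₗ[ℂ] H) (R : A → H →ₗ[ℂ] H')
    (hadj : ∀ a u w, inner ℂ (S a u) w = inner ℂ u (R a w))
    (hRS : ∀ (u : A → H') a, R a (∑ a', S a' (u a')) = u a)
    (P : Submodule ℂ H) (P' : Submodule ℂ H')
    (hP : ∀ u, u ∈ P ↔ (∀ a, R a u ∈ P') ∧ ∑ a, R a u = 0 ∧ ∑ a, S a (R a u) = u) :
    ∃ U : P ≃ₗᵢ[ℂ] PiLp 2 (fun _ : Fin r => P'),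
      (∀ (f : P) j, (U f j : H') = ∑ a, starRingEnd ℂ (ξ.coef j a) • R a f) ∧
      ∀ (f : P) a, R a f = ∑ j, ξ.coef j a • (U f j : H') := by
  let T : PiLp 2 (fun _ : Fin r => P') →ₗ[ℂ] H :=
    { toFun := fun g => ∑ a, S a (∑ j, ξ.coef j a • (g j : H'))
      map_add' := fun g g' => by
        simp only [PiLp.add_apply, Submodule.coe_add, smul_add, Finset.sum_add_distrib, map_add]
      map_smul' := fun c g => by
        simp only [PiLp.smul_apply, Submodule.coe_smul, smul_comm _ c, ← Finset.smul_sum, map_smul,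
          RingHom.id_apply] }
  have hRT : ∀ g a, R a (T g) = ∑ j, ξ.coef j a • (g j : H') := fun g a => hRS _ a
  have hTP : ∀ g, T g ∈ P := fun g => (hP _).2
    ⟨fun a => by
      rw [hRT]
      exact P'.sum_mem fun j _ => P'.smul_mem _ (g j).2,
    by simp only [hRT, ξ.sum_sum_coef_smul], by simp only [hRT]; rfl⟩
  have hTn : ∀ g, ‖T g‖ = ‖g‖ := by
    intro g
    have h1 : inner ℂ (T g) (T g) = inner ℂ g g := by
      change inner ℂ (∑ a, S a (∑ j, ξ.coef j a • (g j : H'))) (T g) = _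
      rw [sum_inner, PiLp.inner_apply]
      simp only [hadj, hRT, sum_inner, inner_smul_left]
      rw [Finset.sum_comm]
      refine Finset.sum_congr rfl fun i _ => ?_
      rw [Submodule.coe_inner]
      have h2 := congrArg (inner ℂ (g i : H')) (ξ.sum_conj_smul_sum (fun j => (g j : H')) i)
      rw [inner_sum] at h2
      simpa only [inner_smul_right] using h2
    rw [@norm_eq_sqrt_re_inner ℂ, @norm_eq_sqrt_re_inner ℂ, h1]
  let T' : PiLp 2 (fun _ : Fin r => P') →ₗᵢ[ℂ] P :=
    { toLinearMap := T.codRestrict P hTP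
      norm_map' := hTn }
  have hsurj : Function.Surjective T' := by
    rintro ⟨f, hf⟩
    obtain ⟨h1, h2, h3⟩ := (hP f).1 hf
    refine ⟨WithLp.toLp 2 fun j => ⟨∑ a, starRingEnd ℂ (ξ.coef j a) • R a f,
      P'.sum_mem fun a _ => P'.smul_mem _ (h1 a)⟩, Subtype.ext ?_⟩
    change ∑ a, S a (∑ j, ξ.coef j a • ∑ a', starRingEnd ℂ (ξ.coef j a') • R a' f) = f
    simp only [ξ.sum_coef_smul_sum (fun a => R a f) h2, h3]
  let U := (LinearIsometryEquiv.ofSurjective T' hsurj).symm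
  have hR : ∀ (f : P) a, R a f = ∑ j, ξ.coef j a • (U f j : H') := by
    intro f a
    have h1 : (f : H) = T (U f) :=
      congrArg Subtype.val ((LinearIsometryEquiv.ofSurjective T' hsurj).apply_symm_apply f).symm
    conv_lhs => rw [h1]
    exact hRT _ _
  refine ⟨U, fun f j => ?_, hR⟩
  simp only [hR]
  exact (ξ.sum_conj_smul_sum (fun j => (U f j : H')) j).symm

/-! ### The graphs of parts and orthogonal sums -/

namespace LinearPMap

variable {E : Type*} [NormedAddCommGroup E] [InnerProductSpace ℂ E]

theorem mem_graph_part_iff (T : E →ₗ.[ℂ] E) (M : Submodule ℂ E) (x y : M) :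
    (x, y) ∈ (T.part M).graph ↔ ((x : E), (y : E)) ∈ T.graph := by
  rw [mem_graph_iff, mem_graph_iff]
  constructor
  · rintro ⟨z, rfl, hz⟩
    exact ⟨⟨_, z.2.1⟩, rfl, congrArg Subtype.val hz⟩
  · rintro ⟨z, hz, hz'⟩
    simp only at hz hz'
    have hx : (x : E) ∈ T.domain := hz ▸ z.2
    obtain rfl : z = ⟨x, hx⟩ := Subtype.ext hz
    exact ⟨⟨x, hx, hz' ▸ y.2⟩, rfl, Subtype.ext hz'⟩

theorem mem_graph_copies_iff (T : E →ₗ.[ℂ] E) (r : ℕ) (x y : PiLp 2 (fun _ : Fin r => E)) :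
    (x, y) ∈ (T.copies r).graph ↔ ∀ i, (x i, y i) ∈ T.graph := by
  simp only [mem_graph_iff]
  constructor
  · rintro ⟨z, rfl, rfl⟩ i
    exact ⟨⟨z.1 i, z.2 i⟩, rfl, rfl⟩
  · intro h
    choose z hz hz' using h
    have hx : ∀ i, x i ∈ T.domain := fun i => hz i ▸ (z i).2
    refine ⟨⟨x, hx⟩, rfl, ?_⟩
    ext1 i
    have hzi : z i = ⟨x i, hx i⟩ := Subtype.ext (hz i)
    rw [← hz' i, hzi]
    rfl

end LinearPMap

namespace MetricTree

variable {V V' : Type*} {Γ : MetricTree V} {Γ' : MetricTree V'} {b b' : ℕ → ℕ} {t t' : ℕ → ℝ}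

theorem Spinor.inner_map {S : Γ'.L2 →ₗ[ℂ] Γ.L2} {R : Γ.L2 →ₗ[ℂ] Γ'.L2}
    (h : ∀ u w, inner ℂ (S u) w = inner ℂ u (R w)) (f : Γ'.Spinor) (g : Γ.Spinor) :
    inner ℂ (Spinor.map S f) g = inner ℂ f (Spinor.map R g) := by
  rw [Spinor.inner_eq, Spinor.inner_eq]
  exact Finset.sum_congr rfl fun i _ => h _ _

theorem BranchMatch.unitarilyEquiv {v : V} (M : BranchMatch Γ Γ' v) (h : Γ.IsRegular b t)
    (h' : Γ'.IsRegular b' t') (hb : ∀ n, 0 < n → b (Γ.gen v + n) = b' n) (hv : 0 < Γ.gen v)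
    (c : ℝ) {r : ℕ} (hr : Γ.branching v = r + 1) :
    LinearPMap.UnitarilyEquiv ((Γ.dirac c).part (tensorC2 (Γ.FPrime v)))
      (((Γ'.dirac c).part (tensorC2 Γ'.FSymm)).copies r) := by
  classical
  obtain ⟨ξ⟩ := BalancedBasis.nonempty (Γ.outEdges v) ((card_outEdges v).trans hr)
  obtain ⟨U, hU, hR⟩ := ξ.exists_unitary (fun a => Spinor.map (M.extend a))
    (fun a => Spinor.map (M.restrict a)) (fun a => Spinor.inner_map (M.inner_extend a))
    (fun f a => Spinor.ext fun i => by
      rw [Spinor.comp_map, Spinor.comp_sum]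
      exact M.restrict_sum_extend (fun a => (f a).comp i) a)
    (tensorC2 (Γ.FPrime v)) (tensorC2 Γ'.FSymm) (fun f => by
      constructor
      · intro hf
        have hF := fun i => (M.mem_FPrime_iff h h').1 (hf i)
        refine ⟨fun a i => (hF i).1 a, Spinor.ext fun i => ?_, Spinor.ext fun i => ?_⟩
        · rw [Spinor.comp_sum]; exact (hF i).2.1
        · rw [Spinor.comp_sum]; exact (hF i).2.2
      · rintro ⟨h1, h2, h3⟩ i
        refine (M.mem_FPrime_iff h h').2 ⟨fun a => h1 a i, ?_, ?_⟩
        · have := congrArg (fun g => Spinor.comp g i) h2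
          simp only [Spinor.comp_sum] at this
          exact this
        · have := congrArg (fun g => Spinor.comp g i) h3
          simp only [Spinor.comp_sum] at this
          exact this)
  refine ⟨U, fun f g => ?_⟩
  rw [LinearPMap.mem_graph_part_iff, LinearPMap.mem_graph_copies_iff]
  simp only [LinearPMap.mem_graph_part_iff, dirac_graph]
  rw [M.mem_diracGraph_iff_restrict h h' hb hv c f.2 g.2]
  -- restrictions and coordinates are linear combinations of each other
  constructor
  · intro hfg j
    have := Submodule.sum_mem (Γ'.diracGraph c) (t := Finset.univ) fun a _ =>
      Submodule.smul_mem _ (starRingEnd ℂ (ξ.coef j a)) (hfg a)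
    rw [hU, hU]
    convert this
    · simp [Prod.fst_sum]
    · simp [Prod.snd_sum]
  · intro hfg a
    have := Submodule.sum_mem (Γ'.diracGraph c) (t := Finset.univ) fun j _ =>
      Submodule.smul_mem _ (ξ.coef j a) (hfg j)
    rw [hR, hR]
    convert this
    · simp [Prod.fst_sum]
    · simp [Prod.snd_sum]

end MetricTree

end

theorem theorem3 {V V' : Type*} (Γ : MetricTree V) (b : ℕ → ℕ) (t : ℕ → ℝ)
    (hΓ : Γ.IsRegular b t) (c : ℝ) (v : V) (k : ℕ) (hv : Γ.gen v = k) (hk : 0 < k)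
    (Γk : MetricTree V')
    (hΓk : Γk.IsRegular (fun n => if n = 0 then 1 else b (k + n)) (fun n => t (k + n) - t k)) :
    (Γ.dirac c).LeavesInvariant (MetricTree.tensorC2 (Γ.FPrime v)) ∧
    (Γk.dirac c).LeavesInvariant (MetricTree.tensorC2 Γk.FSymm) ∧
    LinearPMap.UnitarilyEquiv
      ((Γ.dirac c).part (MetricTree.tensorC2 (Γ.FPrime v)))
      (((Γk.dirac c).part (MetricTree.tensorC2 Γk.FSymm)).copies (b k - 1)) := by
  subst hv
  have hb : ∀ n, 0 < n → b (Γ.gen v + n) = if n = 0 then 1 else b (Γ.gen v + n) :=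
    fun n hn => (if_neg hn.ne').symm
  obtain ⟨M⟩ := MetricTree.exists_branchMatch hΓ hΓk v hb fun n => by ring
  refine ⟨M.leavesInvariant_FPrime hΓ hΓk c, hΓk.leavesInvariant_FSymm c,
    M.unitarilyEquiv hΓ hΓk hb hk c ?_⟩
  have h2 := hΓ.two_le_b _ hk
  rw [hΓ.branching_eq]
  omega
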